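/- **Setting.** Let $D\ge 2$ and let $\Lambda$ be Lebesgue measure on $[0,1]$. *Strategies.* A single-edge strategy is a vector $\vec p=(p_1,\dots,p_D)$ of Borel functions $p_k:[0,1]^D\to[0,1]$ with $\sum_k p_k\equiv 1$; here $p_k(\vec u)$ is the probability of choosing $u_k$ when the i.i.d. $\mathrm{Unif}[0,1]$ labels $U^1,\dots,U^D$ take the values $\vec u=(u_1,\dots,u_D)$. Let $\sigma_{\vec p}$ be the law of the chosen label and let $$f_{\vec p}(y)=\sum_{k=1}^D\int_{[0,1]^{D-1}}p_k(u_1,\dots,u_{k-1},y,u_{k+1},\dots,u_D)\,\prod_{i\ne k}du_i .$$ The strategy $\vec p$ is *deterministic* if for $\Lambda^{\times D}$-a.e. $\vec u$ every $p_k(\vec u)$ is $0$ or $1$. It is *consistent* if, for all $\vec u\in[0,1]^D$, (a) with $\iota_j(\vec u)=(u_j,\dots,u_D,u_1,\dots,u_{j-1})$ ($j$ taken modulo $D$), for every $i$ the value $p_k(\iota_{i-k+1}(\vec u))$ does not depend on $k$, and (b) each $p_i$ is invariant under the permutations of the coordinates that fix position $i$. Put $f_{MAX}(y)=Dy^{D-1}$.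 *The set $\mathcal R$.* Let $(U_i^j)_{i\ge0,\,1\le j\le D}$ be i.i.d. $\mathrm{Unif}[0,1]$. For $\pi\in\{1,\dots,D\}^{n}$, $\pi=(\pi_0,\dots,\pi_{n-1})$, put $\frac1n\mu_\pi=\frac1n\sum_{i=0}^{n-1}\delta_{U_i^{\pi_i}}$. For a finite Borel measure $\nu$ on $[0,1]$ let $\min^j_{n}(\nu)$ be the $j$-th smallest, counted with multiplicity, of the $D^n$ Lévy–Prokhorov distances between $\frac1n\mu_\pi$ and $\nu$ ($+\infty$ if $j>D^n$). The grid entropy of $\nu$ is $$\|\nu\|=\sup\Big\{\alpha\ge0:\ \lim_{n\to\infty}{\min}_{n}^{\lfloor e^{\alpha n}\rfloor}(\nu)=0\ \text{a.s.}\Big\},\qquad \sup\emptyset=-\infty,$$ and $\mathcal R$ is the set of Borel probability measures $\nu$ on $[0,1]$ with $\|\nu\|\ge0$. **Theorem B.** For every single-edge strategy $\vec p$, the measure $\sigma_{\vec p}$ has density $f_{\vec p}$ with respect to $\Lambda$, and the following are equivalent. (i) $\sigma_{\vec p}$ is an extreme point of $\{\sigma_{\vec q}:\vec q\text{ a single-edge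 strategy}\}$. (ii) Every consistent single-edge strategy $\vec q$ with $\sigma_{\vec q}=\sigma_{\vec p}$ is deterministic. (iii) $f_{\vec p}$ has no level sets of positive $\Lambda$-measure, and there is a single-edge strategy $\vec q$ with $\sigma_{\vec q}=\sigma_{\vec p}$ and, for every $k$, $q_k(\vec u)=\mathbf 1_{\{f_{\vec p}(u_k)\ge f_{\vec p}(u_i)\ \forall i\}}$ for $\Lambda^{\times D}$-a.e. $\vec u$ (choose the label that maximizes $f_{\vec p}$). (iv) For $U\sim\mathrm{Unif}[0,1]$, $\frac1Df_{\vec p}(U)$ has the $\mathrm{Beta}(\frac1{D-1},1)$ distribution; equivalently, $f_{\vec p}(U)$ has the same distribution as $f_{MAX}(U)$. Moreover, $\mathcal R$ is the closure, for weak convergence of measures, of the convex hull of the set of those $\sigma_{\vec p}$ for which $\vec p$ satisfies the equivalent conditions (i)–(iv). -/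

import Mathlib

open MeasureTheory ProbabilityTheory Filter Topology
open scoped NNReal ENNReal unitInterval

noncomputable section

/-- A single-edge strategy for `D` labels, given by its conditional probabilities: `prob k u` is the
probability of choosing the `k`-th label when the observed labels are `u = (u₁, …, u_D)`. -/
structure SingleEdgeStrategy (D : ℕ) where
  prob : Fin D → (Fin D → I) → ℝ
  measurable_prob : ∀ k, Measurable (prob k)
  prob_nonneg : ∀ k u, 0 ≤ prob k u
  sum_prob : ∀ u, ∑ k, prob k u = 1

namespace SingleEdgeStrategy

variable {D : ℕ}

/-- The joint law `ψ` on `[0,1]^D × {1, …, D}` of the observed labels and the chosen index: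
`ψ (A × B) = ∫_A ∑_{k ∈ B} p_k dΛ^D`. -/
def jointLaw (p : SingleEdgeStrategy D) : Measure ((Fin D → I) × Fin D) :=
  ∑ k, ((volume : Measure (Fin D → I)).withDensity (fun u => ENNReal.ofReal (p.prob k u))).map
    (fun u => (u, k))

/-- Under `ψ` the labels are i.i.d. uniform on `[0,1]`. -/
theorem map_fst_jointLaw (p : SingleEdgeStrategy D) :
    p.jointLaw.map Prod.fst = (volume : Measure (Fin D → I)) := by
  ext A hA
  have hm : Measurable (Prod.fst : (Fin D → I) × Fin D → (Fin D → I)) := measurable_fst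
  rw [Measure.map_apply hm hA, jointLaw, Measure.finsetSum_apply]
  have h1 : ∀ k : Fin D,
      (((volume : Measure (Fin D → I)).withDensity (fun u => ENNReal.ofReal (p.prob k u))).map
        (fun u => (u, k))) (Prod.fst ⁻¹' A) = ∫⁻ u in A, ENNReal.ofReal (p.prob k u) := by
    intro k
    rw [Measure.map_apply (by fun_prop) (hm hA), withDensity_apply _ (by exact hA)]
    rfl
  simp_rw [h1]
  rw [← lintegral_finsetSum _ (fun k _ => (p.measurable_prob k).ennreal_ofReal)]
  have h2 : ∀ u, ∑ k, ENNReal.ofReal (p.prob k u) = 1 := by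
    intro u
    rw [← ENNReal.ofReal_sum_of_nonneg (fun k _ => p.prob_nonneg k u), p.sum_prob u,
      ENNReal.ofReal_one]
  simp [h2]

instance (p : SingleEdgeStrategy D) : IsProbabilityMeasure p.jointLaw where
  measure_univ := by
    have h := congrArg (fun μ : Measure (Fin D → I) => μ Set.univ) p.map_fst_jointLaw
    simpa [Measure.map_apply measurable_fst MeasurableSet.univ] using h

/-- The law `σ_p` of the chosen label `X = U^J`, where `(U, J)` has law `ψ`. -/
def law (p : SingleEdgeStrategy D) : FiniteMeasure I :=
  ⟨p.jointLaw.map (fun x => x.1 x.2), inferInstance⟩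

/-- The density `f_p` of `σ_p`:
`f_p y = ∑_k ∫ p_k (u₁, …, u_{k-1}, y, u_{k+1}, …, u_D) dΛ^{D-1}`. The integral is written over all
`D` coordinates; the `k`-th one is overwritten by `y`, so it only contributes a factor
`Λ [0,1] = 1`. -/
def density (p : SingleEdgeStrategy D) (y : I) : ℝ :=
  ∑ k, ∫ u : Fin D → I, p.prob k (Function.update u k y)

/-- `p` is deterministic: for a.e. list of labels, every `p_k` is `0` or `1`. -/
def IsDeterministic (p : SingleEdgeStrategy D) : Prop :=
  ∀ᵐ u : Fin D → I, ∀ k, p.prob k u = 0 ∨ p.prob k u = 1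

/-- `p` is consistent: the probability of choosing the label `u_i` does not change when the list is
rotated cyclically (rotating by `i - k` moves `u_i` to position `k`; the arithmetic in `Fin D` is
modulo `D`), and `p_i` is invariant under the permutations of the labels that fix position `i`. -/
def IsConsistent (p : SingleEdgeStrategy D) : Prop :=
  (∀ (i k l : Fin D) (u : Fin D → I),
    p.prob k (fun j => u (j + (i - k))) = p.prob l (fun j => u (j + (i - l)))) ∧
  (∀ (i : Fin D) (π : Equiv.Perm (Fin D)), π i = i → ∀ u : Fin D → I,
    p.prob i (fun j => u (π j)) = p.prob i u)

/-- `q` is the greedy strategy for `f : [0,1] → ℝ`: for a.e. list of labels, it chooses a label at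
which `f` is maximal, `q_k = 1_{f(u_k) ≥ f(u_i) for all i}`. -/
def IsGreedyFor (q : SingleEdgeStrategy D) (f : I → ℝ) : Prop :=
  ∀ k, ∀ᵐ u : Fin D → I, q.prob k u = Set.indicator {v | ∀ i, f (v i) ≤ f (v k)} 1 u

end SingleEdgeStrategy

/-- The set of all laws `σ_p`, where `p` is a single-edge strategy for `D` labels. -/
def achievableLaws (D : ℕ) : Set (FiniteMeasure I) :=
  Set.range (SingleEdgeStrategy.law (D := D))

/-- The density `f_MAX y = D y^{D-1}` of the maximum of `D` independent uniform labels. -/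
def maxDensity (D : ℕ) (y : I) : ℝ := D * (y : ℝ) ^ (D - 1)

/-- The law of the environment: i.i.d. labels `U_i^j`, uniform on `[0,1]`, for the `D` parallel edges
`j` between the vertices `i` and `i + 1`. -/
def environmentLaw (D : ℕ) : Measure (ℕ → Fin D → I) :=
  Measure.infinitePi (fun _ : ℕ => (volume : Measure (Fin D → I)))

/-- The normalized empirical measure `(1/n) ∑_{i < n} δ_{U_i^{π i}}` along the path `π` from `0` to
`n`. -/
def pathEmpiricalMeasure {D : ℕ} (U : ℕ → Fin D → I) {n : ℕ} (π : Fin n → Fin D) : Measure I :=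
  (n : ℝ≥0∞)⁻¹ • ∑ i : Fin n, Measure.dirac (U i (π i))

/-- The `j`-th smallest value (`j ≥ 1`, with multiplicity) of the Lévy–Prokhorov distance between `ν`
and the empirical measures along the `D ^ n` paths from `0` to `n`; it is `∞` if `j > D ^ n`. -/
def pathOrderStatistic {D : ℕ} (U : ℕ → Fin D → I) (ν : FiniteMeasure I) (n j : ℕ) : ℝ≥0∞ :=
  sInf {r : ℝ≥0∞ |
    j ≤ Set.ncard {π : Fin n → Fin D |
      levyProkhorovEDist (pathEmpiricalMeasure U π) (ν : Measure I) ≤ r}}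

/-- The grid entropy of `ν`: the supremum of the exponents `α ≥ 0` such that a.s. the
`⌊e^{α n}⌋`-th smallest distance above tends to `0` as `n → ∞`; it is `-∞` if there is none. -/
def gridEntropy (D : ℕ) (ν : FiniteMeasure I) : EReal :=
  sSup ((fun α : ℝ => (α : EReal)) '' {α : ℝ | 0 ≤ α ∧
    ∀ᵐ U ∂(environmentLaw D),
      Tendsto (fun n : ℕ => pathOrderStatistic U ν n ⌊Real.exp (α * n)⌋₊) atTop (𝓝 0)})

/-- The set `ℛ` of probability measures on `[0,1]` of finite grid entropy (grid entropy only takes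
values in `{-∞} ∪ [0, log D]`, so that finite means nonnegative). -/
def finiteGridEntropyMeasures (D : ℕ) : Set (FiniteMeasure I) :=
  {ν | ν.mass = 1 ∧ 0 ≤ gridEntropy D ν}

end

noncomputable section

section UpdateCoordinate

variable {ι α : Type*} [Fintype ι] [DecidableEq ι] [MeasureSpace α]
  [IsProbabilityMeasure (volume : Measure α)]

/-- Resampling one coordinate preserves the product measure. -/
theorem measurePreserving_update (k : ι) :
    MeasurePreserving (fun z : α × (ι → α) => Function.update z.2 k z.1)
      (volume.prod volume) volume := by
  have hm : Measurable (fun z : α × (ι → α) => Function.update z.2 k z.1) := by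
    refine measurable_pi_lambda _ fun i => ?_
    by_cases h : i = k
    · subst h
      simpa using measurable_fst
    · simp only [Function.update_of_ne h]
      fun_prop
  refine ⟨hm, ?_⟩
  refine (Measure.pi_eq (μ := fun _ : ι => (volume : Measure α)) fun s hs => ?_).symm
  rw [Measure.map_apply hm (MeasurableSet.univ_pi hs)]
  have hset : (fun z : α × (ι → α) => Function.update z.2 k z.1) ⁻¹' (Set.univ.pi s)
      = s k ×ˢ Set.univ.pi (Function.update s k Set.univ) := by
    ext z
    simp only [Set.mem_preimage, Set.mem_pi, Set.mem_univ, true_imp_iff, Set.mem_prod]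
    constructor
    · intro h
      refine ⟨by simpa using h k, fun i => ?_⟩
      by_cases hi : i = k
      · subst hi; simp
      · simpa [hi] using h i
    · rintro ⟨h1, h2⟩ i
      by_cases hi : i = k
      · subst hi; simpa using h1
      · simpa [hi] using h2 i
  rw [hset, Measure.prod_prod, volume_pi, Measure.pi_pi,
    ← Finset.mul_prod_erase Finset.univ _ (Finset.mem_univ k),
    ← Finset.mul_prod_erase Finset.univ (fun i => volume (s i)) (Finset.mem_univ k)]
  simp only [Function.update_self, measure_univ, one_mul]
  congr 1
  refine Finset.prod_congr rfl fun i hi => ?_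
  rw [Function.update_of_ne (Finset.ne_of_mem_erase hi)]

theorem ae_ae_update {P : (ι → α) → Prop} (h : ∀ᵐ u, P u) (k : ι) :
    ∀ᵐ y : α, ∀ᵐ u : ι → α, P (Function.update u k y) :=
  Measure.ae_ae_of_ae_prod ((measurePreserving_update k).quasiMeasurePreserving.ae h)

theorem integral_eq_integral_update {F : (ι → α) → ℝ} (hF : Integrable F) (k : ι) :
    ∫ u, F u = ∫ y : α, ∫ u : ι → α, F (Function.update u k y) := by
  have h := measurePreserving_update (α := α) k
  calc ∫ u, F u = ∫ u, F u ∂((volume.prod volume).map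
        (fun z : α × (ι → α) => Function.update z.2 k z.1)) := by rw [h.map_eq]
    _ = _ := by
      rw [integral_map h.measurable.aemeasurable (by rw [h.map_eq]; exact hF.1)]
      exact integral_prod _ (h.integrable_comp_of_integrable hF)

theorem integral_eq_integral_update' {F : (ι → α) → ℝ} (hF : Integrable F) (k : ι) :
    ∫ u, F u = ∫ u : ι → α, ∫ y : α, F (Function.update u k y) := by
  have h := measurePreserving_update (α := α) k
  rw [integral_eq_integral_update hF k]
  exact integral_integral_swap (h.integrable_comp_of_integrable hF)

end UpdateCoordinate

theorem integrable_of_measurable_of_abs_le {α : Type*} [MeasurableSpace α] {μ : Measure α}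
    [IsFiniteMeasure μ] {f : α → ℝ} (hf : Measurable f) {C : ℝ} (hC : ∀ x, |f x| ≤ C) :
    Integrable f μ :=
  Integrable.of_bound hf.aestronglyMeasurable C (Eventually.of_forall hC)

@[fun_prop]
theorem measurable_update_uncurry {ι α : Type*} [DecidableEq ι] [MeasurableSpace α] (k : ι)
    {β : Type*} [MeasurableSpace β] {f : β → ι → α} {g : β → α} (hf : Measurable f)
    (hg : Measurable g) : Measurable (fun b => Function.update (f b) k (g b)) := by
  refine measurable_pi_lambda _ fun i => ?_
  by_cases h : i = k
  · subst h; simpa using hg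
  · simp only [Function.update_of_ne h]; fun_prop

namespace SingleEdgeStrategy

variable {D : ℕ}

theorem prob_le_one (p : SingleEdgeStrategy D) (k : Fin D) (u : Fin D → I) : p.prob k u ≤ 1 := by
  rw [← p.sum_prob u]
  exact Finset.single_le_sum (f := fun k => p.prob k u) (fun i _ => p.prob_nonneg i u)
    (Finset.mem_univ k)

theorem abs_prob_le_one (p : SingleEdgeStrategy D) (k : Fin D) (u : Fin D → I) :
    |p.prob k u| ≤ 1 := by
  rw [abs_of_nonneg (p.prob_nonneg k u)]; exact p.prob_le_one k u

theorem integrable_prob (p : SingleEdgeStrategy D) (k : Fin D) : Integrable (p.prob k) :=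
  integrable_of_measurable_of_abs_le (p.measurable_prob k) (p.abs_prob_le_one k)

theorem abs_prob_mul_le (p : SingleEdgeStrategy D) {φ : I → ℝ} {C : ℝ} (hC : ∀ y, |φ y| ≤ C)
    (k : Fin D) (u : Fin D → I) (y : I) : |p.prob k u * φ y| ≤ C := by
  rw [abs_mul]
  exact (mul_le_of_le_one_left (abs_nonneg _) (p.abs_prob_le_one k u)).trans (hC y)

theorem integrable_prob_mul (p : SingleEdgeStrategy D) {φ : I → ℝ} (hφ : Measurable φ) {C : ℝ}
    (hC : ∀ y, |φ y| ≤ C) (k : Fin D) : Integrable (fun u => p.prob k u * φ (u k)) := by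
  have := p.measurable_prob k
  exact integrable_of_measurable_of_abs_le (by fun_prop)
    (fun u => p.abs_prob_mul_le hC k u (u k))

theorem integrable_sum_prob_mul (p : SingleEdgeStrategy D) {φ : I → ℝ} (hφ : Measurable φ)
    {C : ℝ} (hC : ∀ y, |φ y| ≤ C) : Integrable (fun u => ∑ k, p.prob k u * φ (u k)) :=
  integrable_finsetSum _ fun k _ => p.integrable_prob_mul hφ hC k

theorem measurable_chosen : Measurable (fun x : (Fin D → I) × Fin D => x.1 x.2) :=
  measurable_from_prod_countable_left fun k => measurable_pi_apply k

instance (p : SingleEdgeStrategy D) : IsProbabilityMeasure (p.law : Measure I) :=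
  Measure.isProbabilityMeasure_map (measurable_chosen).aemeasurable

theorem integral_law (p : SingleEdgeStrategy D) {φ : I → ℝ} (hφ : Measurable φ) {C : ℝ}
    (hC : ∀ y, |φ y| ≤ C) :
    ∫ y, φ y ∂(p.law : Measure I) = ∫ u, ∑ k, p.prob k u * φ (u k) := by
  have hlaw : (p.law : Measure I) = p.jointLaw.map (fun x => x.1 x.2) := rfl
  have hc := measurable_chosen (D := D)
  have hφc : Measurable (fun x : (Fin D → I) × Fin D => φ (x.1 x.2)) := hφ.comp hc
  rw [hlaw, integral_map hc.aemeasurable hφ.aestronglyMeasurable]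
  have hfin : ∀ k, IsFiniteMeasure ((volume : Measure (Fin D → I)).withDensity
      (fun u => ENNReal.ofReal (p.prob k u))) := fun k =>
    isFiniteMeasure_withDensity_ofReal (p.integrable_prob k).2
  rw [integral_finsetSum _ fun k _ => p.integrable_prob_mul hφ hC k]
  rw [jointLaw, integral_finsetSum_measure fun k _ =>
    integrable_of_measurable_of_abs_le hφc (fun x => hC _)]
  refine Finset.sum_congr rfl fun k _ => ?_
  rw [integral_map (by fun_prop) hφc.aestronglyMeasurable,
    integral_withDensity_eq_integral_toReal_smul (p.measurable_prob k).ennreal_ofReal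
      (Eventually.of_forall fun _ => ENNReal.ofReal_lt_top)]
  simp [ENNReal.toReal_ofReal (p.prob_nonneg k _)]

theorem law_ext {p q : SingleEdgeStrategy D}
    (h : ∀ (φ : I → ℝ), Measurable φ → (∀ y, |φ y| ≤ 1) →
      ∫ u, ∑ k, p.prob k u * φ (u k) = ∫ u, ∑ k, q.prob k u * φ (u k)) : p.law = q.law := by
  apply Subtype.ext
  apply Measure.ext
  intro A hA
  have hφ : Measurable (A.indicator (1 : I → ℝ)) := measurable_one.indicator hA
  have hC : ∀ y, |A.indicator (1 : I → ℝ) y| ≤ 1 := by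
    intro y; by_cases hy : y ∈ A <;> simp [hy]
  have h1 := h _ hφ hC
  rw [← p.integral_law hφ hC, ← q.integral_law hφ hC, integral_indicator_one hA,
    integral_indicator_one hA] at h1
  exact (measureReal_eq_measureReal_iff (measure_ne_top (p.law : Measure I) A)
    (measure_ne_top (q.law : Measure I) A)).1 h1

@[fun_prop]
theorem measurable_density (p : SingleEdgeStrategy D) : Measurable p.density := by
  unfold density
  refine Finset.measurable_sum _ fun k _ => ?_
  have : StronglyMeasurable (fun z : I × (Fin D → I) => p.prob k (Function.update z.2 k z.1)) :=
    ((p.measurable_prob k).comp (by fun_prop)).stronglyMeasurable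
  exact this.integral_prod_right.measurable

theorem density_nonneg (p : SingleEdgeStrategy D) (y : I) : 0 ≤ p.density y :=
  Finset.sum_nonneg fun k _ => integral_nonneg fun _ => p.prob_nonneg k _

theorem density_le (p : SingleEdgeStrategy D) (y : I) : p.density y ≤ D := by
  have : ∀ k ∈ Finset.univ, ∫ u : Fin D → I, p.prob k (Function.update u k y) ≤ 1 := by
    intro k _
    have hm := p.measurable_prob k
    calc ∫ u : Fin D → I, p.prob k (Function.update u k y) ≤ ∫ u : Fin D → I, (1 : ℝ) :=
          integral_mono (integrable_of_measurable_of_abs_le (by fun_prop)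
            fun u => p.abs_prob_le_one k _) (integrable_const _) fun u => p.prob_le_one k _
      _ = 1 := by simp
  simpa [density] using Finset.sum_le_sum this

theorem abs_density_le (p : SingleEdgeStrategy D) (y : I) : |p.density y| ≤ D := by
  rw [abs_of_nonneg (p.density_nonneg y)]; exact p.density_le y

theorem integral_sum_prob_mul (p : SingleEdgeStrategy D) {φ : I → ℝ} (hφ : Measurable φ) {C : ℝ}
    (hC : ∀ y, |φ y| ≤ C) :
    ∫ u, ∑ k, p.prob k u * φ (u k) = ∫ y, φ y * p.density y := by
  rw [integral_finsetSum _ fun k _ => p.integrable_prob_mul hφ hC k]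
  simp_rw [density, Finset.mul_sum]
  have key : ∀ k, ∫ u, p.prob k u * φ (u k)
      = ∫ y, φ y * ∫ u : Fin D → I, p.prob k (Function.update u k y) := by
    intro k
    rw [integral_eq_integral_update (p.integrable_prob_mul hφ hC k) k]
    simp_rw [Function.update_self, integral_mul_const, mul_comm]
  rw [integral_finsetSum]
  · exact Finset.sum_congr rfl fun k _ => key k
  · intro k _
    have := (integrable_of_measurable_of_abs_le (μ := volume.prod volume)
      (f := fun z : I × (Fin D → I) => φ z.1 * p.prob k (Function.update z.2 k z.1))
      (by have := p.measurable_prob k; fun_prop)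
      (fun z => by rw [mul_comm]; exact p.abs_prob_mul_le hC k _ _)).integral_prod_left
    simpa only [integral_const_mul] using this

theorem integral_law_eq_density (p : SingleEdgeStrategy D) {φ : I → ℝ} (hφ : Measurable φ) {C : ℝ}
    (hC : ∀ y, |φ y| ≤ C) :
    ∫ y, φ y ∂(p.law : Measure I) = ∫ y, φ y * p.density y := by
  rw [p.integral_law hφ hC, p.integral_sum_prob_mul hφ hC]

theorem integrable_density (p : SingleEdgeStrategy D) : Integrable p.density :=
  integrable_of_measurable_of_abs_le p.measurable_density p.abs_density_le

theorem law_eq_withDensity (p : SingleEdgeStrategy D) :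
    (p.law : Measure I) =
      (volume : Measure I).withDensity (fun y => ENNReal.ofReal (p.density y)) := by
  ext A hA
  have hφ : Measurable (A.indicator (1 : I → ℝ)) := measurable_one.indicator hA
  have hC : ∀ y, |A.indicator (1 : I → ℝ) y| ≤ 1 := by
    intro y; by_cases hy : y ∈ A <;> simp [hy]
  have h1 := p.integral_law_eq_density hφ hC
  rw [integral_indicator_one hA] at h1
  have h2 : ∫ y, A.indicator (1 : I → ℝ) y * p.density y = ∫ y in A, p.density y := by
    rw [← integral_indicator hA]
    congr 1
    ext y
    by_cases hy : y ∈ A <;> simp [hy]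
  rw [withDensity_apply _ hA, ← ofReal_integral_eq_lintegral_ofReal
    p.integrable_density.integrableOn (Eventually.of_forall p.density_nonneg), ← h2, ← h1]
  simp [Measure.real]

theorem law_eq_iff_density_ae_eq {p q : SingleEdgeStrategy D} :
    p.law = q.law ↔ p.density =ᵐ[volume] q.density := by
  have h0 : p.law = q.law ↔ (p.law : Measure I) = q.law :=
    ⟨fun h => by rw [h], fun h => Subtype.ext h⟩
  rw [h0, p.law_eq_withDensity, q.law_eq_withDensity, withDensity_eq_iff_of_sigmaFinite
    p.measurable_density.ennreal_ofReal.aemeasurable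
    q.measurable_density.ennreal_ofReal.aemeasurable]
  constructor
  · intro h
    filter_upwards [h] with y hy
    exact (ENNReal.ofReal_eq_ofReal_iff (p.density_nonneg y) (q.density_nonneg y)).1 hy
  · intro h
    filter_upwards [h] with y hy
    rw [hy]

theorem law_eq_of_prob_ae_eq {p q : SingleEdgeStrategy D}
    (h : ∀ k, ∀ᵐ u, p.prob k u = q.prob k u) : p.law = q.law := by
  refine law_ext fun φ _ _ => integral_congr_ae ?_
  filter_upwards [ae_all_iff.2 h] with u hu
  simp [hu]

end SingleEdgeStrategy

theorem ae_of_ae_ae_update {ι α : Type*} [Fintype ι] [DecidableEq ι] [MeasureSpace α]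
    [IsProbabilityMeasure (volume : Measure α)] {P : (ι → α) → Prop}
    (hP : MeasurableSet {u | P u}) (k : ι)
    (h : ∀ u : ι → α, ∀ᵐ y : α, P (Function.update u k y)) : ∀ᵐ u, P u := by
  have hmp := measurePreserving_update (α := α) k
  rw [← hmp.map_eq, ae_map_iff hmp.measurable.aemeasurable hP]
  have hm : MeasurableSet {z : α × (ι → α) | P (Function.update z.2 k z.1)} := hmp.measurable hP
  rw [Measure.ae_prod_iff_ae_ae hm, Measure.ae_ae_comm hm]
  exact Eventually.of_forall h

/-- If a function has no level sets of positive measure, then its values at two independent points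
are almost surely different. -/
theorem ae_apply_ne_apply {ι α : Type*} [Fintype ι] [MeasureSpace α]
    [IsProbabilityMeasure (volume : Measure α)] {f : α → ℝ} (hf : Measurable f)
    (hlev : ∀ c, volume {y | f y = c} = 0) {k l : ι} (hkl : k ≠ l) :
    ∀ᵐ u : ι → α, f (u k) ≠ f (u l) := by
  classical
  refine ae_of_ae_ae_update ?_ k fun u => ?_
  · exact (measurableSet_eq_fun (by fun_prop) (by fun_prop)).compl
  · rw [ae_iff]
    simpa [Function.update_of_ne hkl.symm] using hlev (f (u l))

theorem volume_unitInterval_singleton_eq_zero (c : ℝ) :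
    volume {y : I | (y : ℝ) = c} = 0 :=
  Set.Subsingleton.measure_zero (fun _ h1 _ h2 => Subtype.ext (h1.trans h2.symm)) _

theorem MeasureTheory.FiniteMeasure.ext_of_real {α : Type*} [MeasurableSpace α]
    {μ ν : FiniteMeasure α}
    (h : ∀ A, MeasurableSet A → (μ : Measure α).real A = (ν : Measure α).real A) : μ = ν := by
  apply Subtype.ext
  apply Measure.ext
  intro A hA
  exact (measureReal_eq_measureReal_iff (measure_ne_top (μ : Measure α) A)
    (measure_ne_top (ν : Measure α) A)).1 (h A hA)

namespace SingleEdgeStrategy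

variable {D : ℕ}

theorem law_real_apply (p : SingleEdgeStrategy D) {A : Set I} (hA : MeasurableSet A) :
    (p.law : Measure I).real A = ∫ u, ∑ k, p.prob k u * A.indicator 1 (u k) := by
  rw [← integral_indicator_one hA, p.integral_law (measurable_one.indicator hA) (C := 1)]
  intro y; by_cases hy : y ∈ A <;> simp [hy]

/-- The mixture of two strategies. -/
def mix (p q : SingleEdgeStrategy D) (a b : ℝ≥0) (hab : a + b = 1) : SingleEdgeStrategy D where
  prob k u := a * p.prob k u + b * q.prob k u
  measurable_prob k := by
    have := p.measurable_prob k
    have := q.measurable_prob k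
    fun_prop
  prob_nonneg k u := by
    have := p.prob_nonneg k u
    have := q.prob_nonneg k u
    positivity
  sum_prob u := by
    rw [Finset.sum_add_distrib, ← Finset.mul_sum, ← Finset.mul_sum, p.sum_prob, q.sum_prob]
    exact_mod_cast congrArg NNReal.toReal (by simpa using hab)

theorem law_mix (p q : SingleEdgeStrategy D) (a b : ℝ≥0) (hab : a + b = 1) :
    (p.mix q a b hab).law = a • p.law + b • q.law := by
  refine FiniteMeasure.ext_of_real fun A hA => ?_
  have hφ : Measurable (A.indicator (1 : I → ℝ)) := measurable_one.indicator hA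
  have hC : ∀ y, |A.indicator (1 : I → ℝ) y| ≤ 1 := by
    intro y; by_cases hy : y ∈ A <;> simp [hy]
  have h1 : ((a • p.law + b • q.law : FiniteMeasure I) : Measure I)
      = a • (p.law : Measure I) + b • (q.law : Measure I) := rfl
  rw [h1, measureReal_add_apply, measureReal_nnreal_smul_apply, measureReal_nnreal_smul_apply,
    law_real_apply _ hA, law_real_apply _ hA, law_real_apply _ hA, ← integral_const_mul,
    ← integral_const_mul, ← integral_add ((p.integrable_sum_prob_mul hφ hC).const_mul _)
      ((q.integrable_sum_prob_mul hφ hC).const_mul _)]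
  congr 1
  ext u
  simp only [mix, add_mul, Finset.sum_add_distrib, Finset.mul_sum, mul_assoc]

theorem convex_achievableLaws : Convex ℝ≥0 (achievableLaws D) := by
  rintro _ ⟨p, rfl⟩ _ ⟨q, rfl⟩ a b _ _ hab
  exact ⟨p.mix q a b hab, law_mix p q a b hab⟩

/-- Add a signed perturbation to the choice probabilities of a strategy. -/
def perturb (p : SingleEdgeStrategy D) (d : Fin D → (Fin D → I) → ℝ) (hd : ∀ k, Measurable (d k))
    (hsum : ∀ u, ∑ k, d k u = 0) (hnonneg : ∀ k u, 0 ≤ p.prob k u + d k u) :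
    SingleEdgeStrategy D where
  prob k u := p.prob k u + d k u
  measurable_prob k := (p.measurable_prob k).add (hd k)
  prob_nonneg := hnonneg
  sum_prob u := by rw [Finset.sum_add_distrib, p.sum_prob, hsum, add_zero]

/-- The perturbation that moves the mass `g` from index `k` to index `l`. -/
def moveMass (g : (Fin D → I) → ℝ) (k l i : Fin D) (u : Fin D → I) : ℝ :=
  (if i = l then g u else 0) - if i = k then g u else 0

theorem measurable_moveMass {g : (Fin D → I) → ℝ} (hg : Measurable g) (k l i : Fin D) :
    Measurable (moveMass g k l i) := by
  unfold moveMass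
  split_ifs <;> fun_prop

theorem sum_moveMass_mul (g : (Fin D → I) → ℝ) (k l : Fin D) (u : Fin D → I) (x : Fin D → ℝ) :
    ∑ i, moveMass g k l i u * x i = g u * (x l - x k) := by
  simp [moveMass, sub_mul, ite_mul, Finset.sum_sub_distrib, mul_sub]

theorem sum_moveMass (g : (Fin D → I) → ℝ) (k l : Fin D) (u : Fin D → I) :
    ∑ i, moveMass g k l i u = 0 := by
  simpa using sum_moveMass_mul g k l u 1

theorem law_eq_of_half_add {p q r : SingleEdgeStrategy D}
    (hp : p.law ∈ Set.extremePoints ℝ≥0 (achievableLaws D))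
    (h : ∀ k u, p.prob k u = 2⁻¹ * q.prob k u + 2⁻¹ * r.prob k u) : q.law = p.law := by
  have hab : (2⁻¹ : ℝ≥0) + 2⁻¹ = 1 := by
    rw [← two_mul]; exact mul_inv_cancel₀ two_ne_zero
  have h1 : p.law = (q.mix r 2⁻¹ 2⁻¹ hab).law :=
    law_eq_of_prob_ae_eq fun k => Eventually.of_forall fun u => by simp [mix, h k u]
  refine hp.2 ⟨q, rfl⟩ ⟨r, rfl⟩ ⟨2⁻¹, 2⁻¹, by positivity, by positivity, hab, ?_⟩
  rw [h1, law_mix]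

theorem prob_mul_prob_eq_zero_of_mem_extremePoints {p : SingleEdgeStrategy D}
    (hp : p.law ∈ Set.extremePoints ℝ≥0 (achievableLaws D)) (k l : Fin D) :
    ∀ᵐ u : Fin D → I, u k < u l → p.prob k u * p.prob l u = 0 := by
  let g : (Fin D → I) → ℝ := {u | u k < u l}.indicator fun u => p.prob k u * p.prob l u
  have hg : Measurable g := by
    refine Measurable.indicator ((p.measurable_prob k).mul (p.measurable_prob l)) ?_
    exact measurableSet_lt (measurable_pi_apply k) (measurable_pi_apply l)
  have hg0 : ∀ u, 0 ≤ g u := fun u =>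
    Set.indicator_nonneg (fun u _ => mul_nonneg (p.prob_nonneg k u) (p.prob_nonneg l u)) u
  have hgk : ∀ u, g u ≤ p.prob k u := fun u =>
    (Set.indicator_le_self' (fun _ _ => mul_nonneg (p.prob_nonneg k _) (p.prob_nonneg l _)) u).trans
      (mul_le_of_le_one_right (p.prob_nonneg k u) (p.prob_le_one l u))
  have hgl : ∀ u, g u ≤ p.prob l u := fun u =>
    (Set.indicator_le_self' (fun _ _ => mul_nonneg (p.prob_nonneg k _) (p.prob_nonneg l _)) u).trans
      (mul_le_of_le_one_left (p.prob_nonneg l u) (p.prob_le_one k u))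
  have hgkl : k = l → ∀ u, g u = 0 := by rintro rfl u; simp [g]
  have hpos : ∀ i u, 0 ≤ p.prob i u + moveMass g k l i u := by
    intro i u
    have h1 := p.prob_nonneg i u
    have h2 := hgk u
    have h3 := hg0 u
    unfold moveMass
    split_ifs with h4 h5 h5
    · linarith
    · linarith
    · subst h5; linarith
    · linarith
  have hneg : ∀ i u, 0 ≤ p.prob i u + moveMass g l k i u := by
    intro i u
    have h1 := p.prob_nonneg i u
    have h2 := hgl u
    have h3 := hg0 u
    unfold moveMass
    split_ifs with h4 h5 h5
    · linarith
    · linarith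
    · subst h5; linarith
    · linarith
  let q := p.perturb (moveMass g k l) (measurable_moveMass hg k l) (sum_moveMass g k l) hpos
  let r := p.perturb (moveMass g l k) (measurable_moveMass hg l k) (sum_moveMass g l k) hneg
  have hq : q.law = p.law := law_eq_of_half_add (r := r) hp fun i u => by
    simp only [q, r, perturb, moveMass]; ring
  have hC : ∀ y : I, |(y : ℝ)| ≤ 1 := fun y => by rw [abs_of_nonneg y.2.1]; exact y.2.2
  have h1 := q.integral_law measurable_subtype_coe hC
  rw [hq, p.integral_law measurable_subtype_coe hC] at h1
  have h2 : ∀ u : Fin D → I, ∑ i, q.prob i u * (u i : ℝ)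
      = ∑ i, p.prob i u * (u i : ℝ) + g u * ((u l : ℝ) - u k) := by
    intro u
    rw [← sum_moveMass_mul g k l u (fun i => (u i : ℝ)), ← Finset.sum_add_distrib]
    exact Finset.sum_congr rfl fun i _ => by simp only [q, perturb, add_mul]
  have hgi : Integrable (fun u : Fin D → I => g u * ((u l : ℝ) - u k)) := by
    refine integrable_of_measurable_of_abs_le (by fun_prop) (C := 1) fun u => ?_
    rw [abs_mul, abs_of_nonneg (hg0 u)]
    refine mul_le_one₀ ((hgk u).trans (p.prob_le_one k u)) (abs_nonneg _) ?_
    rw [abs_le]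
    have h3 := (u l).2
    have h4 := (u k).2
    constructor <;> linarith [h3.1, h3.2, h4.1, h4.2]
  simp_rw [h2] at h1
  rw [integral_add (p.integrable_sum_prob_mul measurable_subtype_coe hC) hgi] at h1
  have h3 : ∫ u : Fin D → I, g u * ((u l : ℝ) - u k) = 0 := by linarith
  rw [integral_eq_zero_iff_of_nonneg _ hgi] at h3
  · filter_upwards [h3] with u hu hlt
    have hlt' : (0 : ℝ) < (u l : ℝ) - u k := sub_pos.2 hlt
    have := (mul_eq_zero.1 hu).resolve_right hlt'.ne'
    simpa [g, hlt] using this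
  · intro u
    by_cases hlt : u k < u l
    · exact mul_nonneg (hg0 u) (sub_nonneg.2 hlt.le)
    · simp [g, hlt]

/-- Every strategy whose law is extreme among the achievable ones is deterministic. -/
theorem isDeterministic_of_mem_extremePoints {p : SingleEdgeStrategy D}
    (hp : p.law ∈ Set.extremePoints ℝ≥0 (achievableLaws D)) : p.IsDeterministic := by
  have h1 : ∀ᵐ u : Fin D → I, ∀ k l, u k < u l → p.prob k u * p.prob l u = 0 :=
    ae_all_iff.2 fun k => ae_all_iff.2 fun l => prob_mul_prob_eq_zero_of_mem_extremePoints hp k l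
  have h2 : ∀ᵐ u : Fin D → I, ∀ k l, k ≠ l → (u k : ℝ) ≠ u l :=
    ae_all_iff.2 fun k => ae_all_iff.2 fun l => by
      by_cases h : k = l
      · exact Eventually.of_forall fun u hn => absurd h hn
      · filter_upwards [ae_apply_ne_apply measurable_subtype_coe
          volume_unitInterval_singleton_eq_zero h] with u hu _ using hu
  filter_upwards [h1, h2] with u hu1 hu2 k
  by_cases hk : p.prob k u = 0
  · exact Or.inl hk
  · right
    rw [← p.sum_prob u, Finset.sum_eq_single k]
    · intro l _ hl
      rcases lt_or_gt_of_ne (hu2 l k hl) with h | h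
      · exact (mul_eq_zero.1 (hu1 l k h)).resolve_right hk
      · exact (mul_eq_zero.1 (hu1 k l h)).resolve_left hk
    · simp

/-- Average a strategy over all relabellings of the list. -/
def symmetrize (p : SingleEdgeStrategy D) : SingleEdgeStrategy D where
  prob k u := ((D.factorial : ℝ))⁻¹ * ∑ τ : Equiv.Perm (Fin D), p.prob (τ k) (u ∘ τ.symm)
  measurable_prob k := by
    refine Measurable.const_mul (Finset.measurable_sum _ fun τ _ => ?_) _
    refine (p.measurable_prob _).comp (measurable_pi_lambda _ fun i => ?_)
    exact measurable_pi_apply _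
  prob_nonneg k u :=
    mul_nonneg (by positivity) (Finset.sum_nonneg fun τ _ => p.prob_nonneg _ _)
  sum_prob u := by
    rw [← Finset.mul_sum, Finset.sum_comm]
    have : ∀ τ : Equiv.Perm (Fin D), ∑ k, p.prob (τ k) (u ∘ τ.symm) = 1 := fun τ => by
      rw [Equiv.sum_comp τ fun k => p.prob k (u ∘ τ.symm), p.sum_prob]
    simp only [this, Finset.sum_const, Finset.card_univ, Fintype.card_perm, Fintype.card_fin,
      nsmul_eq_mul, mul_one]
    exact inv_mul_cancel₀ (by positivity)

theorem symmetrize_prob_comp (p : SingleEdgeStrategy D) (ρ : Equiv.Perm (Fin D)) (k : Fin D)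
    (u : Fin D → I) : p.symmetrize.prob k (u ∘ ρ) = p.symmetrize.prob (ρ k) u := by
  simp only [symmetrize]
  congr 1
  refine Fintype.sum_equiv (Equiv.mulRight ρ⁻¹) _ _ fun τ => ?_
  congr 1
  · simp

theorem isConsistent_symmetrize [NeZero D] (p : SingleEdgeStrategy D) :
    p.symmetrize.IsConsistent := by
  constructor
  · have key : ∀ (i k : Fin D) (u : Fin D → I),
        p.symmetrize.prob k (fun j => u (j + (i - k))) = p.symmetrize.prob i u := by
      intro i k u
      have := p.symmetrize_prob_comp (Equiv.addRight (i - k)) k u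
      rwa [Equiv.coe_addRight, show (fun x => x + (i - k)) k = i from add_sub_cancel k i] at this
    intro i k l u
    rw [key, key]
  · intro i π hπ u
    have := p.symmetrize_prob_comp π i u
    rwa [hπ] at this

theorem law_symmetrize (p : SingleEdgeStrategy D) : p.symmetrize.law = p.law := by
  refine law_ext fun φ hφ hC => ?_
  have key : ∀ τ : Equiv.Perm (Fin D), ∫ u : Fin D → I, ∑ k, p.prob (τ k) (u ∘ τ.symm) * φ (u k)
      = ∫ u, ∑ k, p.prob k u * φ (u k) := by
    intro τ
    have hmp : MeasurePreserving (fun u : Fin D → I => u ∘ τ.symm) volume volume :=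
      volume_preserving_arrowCongr' τ (MeasurableEquiv.refl I) (MeasurePreserving.id _)
    rw [← hmp.integral_comp' (f := (MeasurableEquiv.arrowCongr' τ (MeasurableEquiv.refl I)))
      (fun u => ∑ k, p.prob k u * φ (u k))]
    congr 1
    ext u
    refine (Equiv.sum_comp τ.symm _).symm.trans (Finset.sum_congr rfl fun k _ => ?_)
    rw [τ.apply_symm_apply]
    rfl
  have hsum : ∀ u : Fin D → I, ∑ k, p.symmetrize.prob k u * φ (u k)
      = ((D.factorial : ℝ))⁻¹ * ∑ τ : Equiv.Perm (Fin D),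
        ∑ k, p.prob (τ k) (u ∘ τ.symm) * φ (u k) := by
    intro u
    simp only [symmetrize, mul_assoc]
    rw [← Finset.mul_sum, Finset.sum_comm]
    simp only [Finset.sum_mul]
  simp_rw [hsum]
  rw [integral_const_mul, integral_finsetSum]
  · simp only [key, Finset.sum_const, Finset.card_univ, Fintype.card_perm, Fintype.card_fin,
      nsmul_eq_mul]
    rw [inv_mul_cancel_left₀ (by positivity)]
  · intro τ _
    refine integrable_finsetSum _ fun k _ => ?_
    have hm : Measurable fun u : Fin D → I => u ∘ τ.symm :=
      measurable_pi_lambda _ fun i => measurable_pi_apply _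
    exact integrable_of_measurable_of_abs_le
      (((p.measurable_prob _).comp hm).mul (hφ.comp (measurable_pi_apply k)))
      fun u => p.abs_prob_mul_le hC _ _ _

theorem IsConsistent.mix {p q : SingleEdgeStrategy D} (hp : p.IsConsistent) (hq : q.IsConsistent)
    (a b : ℝ≥0) (hab : a + b = 1) : (p.mix q a b hab).IsConsistent := by
  refine ⟨fun i k l u => ?_, fun i π hπ u => ?_⟩
  · simp only [SingleEdgeStrategy.mix, hp.1 i k l u, hq.1 i k l u]
  · simp only [SingleEdgeStrategy.mix, hp.2 i π hπ u, hq.2 i π hπ u]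

theorem mem_extremePoints_of_forall_isConsistent [NeZero D] {p : SingleEdgeStrategy D}
    (h : ∀ q : SingleEdgeStrategy D, q.IsConsistent → q.law = p.law → q.IsDeterministic) :
    p.law ∈ Set.extremePoints ℝ≥0 (achievableLaws D) := by
  refine ⟨⟨p, rfl⟩, ?_⟩
  rintro _ ⟨p₁, rfl⟩ _ ⟨p₂, rfl⟩ ⟨a, b, ha, hb, hab, hp⟩
  let q := p₁.symmetrize.mix p₂.symmetrize a b hab
  have hq : q.law = p.law := by
    rw [law_mix, law_symmetrize, law_symmetrize, hp]
  have hdet := h q ((isConsistent_symmetrize p₁).mix (isConsistent_symmetrize p₂) a b hab) hq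
  have heq : p₁.symmetrize.law = p₂.symmetrize.law := by
    refine law_eq_of_prob_ae_eq fun k => ?_
    filter_upwards [hdet] with u hu
    have h1 := p₁.symmetrize.prob_nonneg k u
    have h2 := p₂.symmetrize.prob_nonneg k u
    have h3 := p₁.symmetrize.prob_le_one k u
    have h4 := p₂.symmetrize.prob_le_one k u
    have ha' : (0 : ℝ) < a := ha
    have hb' : (0 : ℝ) < b := hb
    have hab' : (a : ℝ) + b = 1 := by exact_mod_cast hab
    rcases hu k with h0 | h0 <;> simp only [q, SingleEdgeStrategy.mix] at h0
    · have e1 := mul_nonneg ha'.le h1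
      have e2 := mul_nonneg hb'.le h2
      have e3 : (a : ℝ) * p₁.symmetrize.prob k u = 0 := by linarith
      have e4 : (b : ℝ) * p₂.symmetrize.prob k u = 0 := by linarith
      rw [(mul_eq_zero.1 e3).resolve_left ha'.ne', (mul_eq_zero.1 e4).resolve_left hb'.ne']
    · have e1 := mul_nonneg ha'.le (sub_nonneg.2 h3)
      have e2 := mul_nonneg hb'.le (sub_nonneg.2 h4)
      have e3 : (a : ℝ) * (1 - p₁.symmetrize.prob k u) = 0 := by linarith
      have e4 : (b : ℝ) * (1 - p₂.symmetrize.prob k u) = 0 := by linarith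
      have e5 := (mul_eq_zero.1 e3).resolve_left ha'.ne'
      have e6 := (mul_eq_zero.1 e4).resolve_left hb'.ne'
      linarith
  rw [law_symmetrize, law_symmetrize] at heq
  rw [← hp, ← heq, ← add_smul, hab, one_smul]

end SingleEdgeStrategy

/-- Exchanging the coordinate `u l` with the coordinate `v m`, on which the integrand does not
depend, does not change the integral. -/
theorem integral_integral_update_eq {ι α : Type*} [Fintype ι] [DecidableEq ι] [MeasureSpace α]
    [IsProbabilityMeasure (volume : Measure α)] {H : (ι → α) → (ι → α) → ℝ}
    (hH : Measurable fun z : (ι → α) × (ι → α) => H z.1 z.2) {C : ℝ} (hC : ∀ u v, |H u v| ≤ C)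
    (l m : ι) (hm : ∀ u v y, H u (Function.update v m y) = H u v) :
    ∫ v, ∫ u, H (Function.update u l (v m)) v = ∫ v, ∫ u, H u v := by
  have hmeas : Measurable fun v : ι → α => ∫ u, H (Function.update u l (v m)) v := by
    have : StronglyMeasurable fun z : (ι → α) × (ι → α) =>
        H (Function.update z.2 l (z.1 m)) z.1 :=
      (hH.comp (f := fun z : (ι → α) × (ι → α) => (Function.update z.2 l (z.1 m), z.1))
        (by fun_prop)).stronglyMeasurable
    exact this.integral_prod_right.measurable
  have hbd : ∀ v : ι → α, |∫ u, H (Function.update u l (v m)) v| ≤ C := fun v => by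
    have h1 := norm_integral_le_of_norm_le_const (μ := (volume : Measure (ι → α)))
      (f := fun u => H (Function.update u l (v m)) v) (C := C)
      (Eventually.of_forall fun u => hC _ _)
    simpa using h1
  rw [integral_eq_integral_update' (integrable_of_measurable_of_abs_le hmeas hbd) m]
  congr 1
  ext v
  simp only [Function.update_self, hm]
  rw [← integral_eq_integral_update (F := fun u => H u v)]
  exact integrable_of_measurable_of_abs_le (hH.comp measurable_prodMk_right) fun u => hC u v

namespace SingleEdgeStrategy

variable {D : ℕ}

/-- `p` almost surely chooses a label at which `h` is maximal, with an arbitrary tie-breaking. -/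
def IsOptimalFor (p : SingleEdgeStrategy D) (h : I → ℝ) : Prop :=
  ∀ᵐ u : Fin D → I, ∀ k l, h (u k) < h (u l) → p.prob k u = 0

/-- The weight of a pair of lists `u`, `v` for which `p` chooses `u k` from `u`, chooses `u l`
when it replaces `v m`, and chooses `v j` when `u k` replaces `v m`, although
`h (u k) < h (u l)`. -/
def cycleWeight (p : SingleEdgeStrategy D) (h : I → ℝ) (k l m j : Fin D) (u v : Fin D → I) : ℝ :=
  if h (u k) < h (u l) then
    p.prob k u * (p.prob m (Function.update v m (u l)) * p.prob j (Function.update v m (u k)))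
  else 0

section CycleWeight

variable (p : SingleEdgeStrategy D) {h : I → ℝ} (k l m j : Fin D)

theorem measurable_cycleWeight (hh : Measurable h) :
    Measurable fun z : (Fin D → I) × (Fin D → I) => p.cycleWeight h k l m j z.1 z.2 := by
  have h1 := p.measurable_prob k
  have h2 := p.measurable_prob m
  have h3 := p.measurable_prob j
  exact Measurable.ite (measurableSet_lt (by fun_prop) (by fun_prop)) (by fun_prop) (by fun_prop)

theorem cycleWeight_nonneg (u v : Fin D → I) : 0 ≤ p.cycleWeight h k l m j u v := by
  unfold cycleWeight
  split_ifs
  · exact mul_nonneg (p.prob_nonneg _ _) (mul_nonneg (p.prob_nonneg _ _) (p.prob_nonneg _ _))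
  · exact le_rfl

theorem cycleWeight_le (u v : Fin D → I) : p.cycleWeight h k l m j u v ≤ p.prob k u *
    (p.prob m (Function.update v m (u l)) * p.prob j (Function.update v m (u k))) := by
  unfold cycleWeight
  split_ifs
  · exact le_rfl
  · exact mul_nonneg (p.prob_nonneg _ _) (mul_nonneg (p.prob_nonneg _ _) (p.prob_nonneg _ _))

theorem cycleWeight_le_left (u v : Fin D → I) : p.cycleWeight h k l m j u v ≤ p.prob k u :=
  (p.cycleWeight_le k l m j u v).trans (mul_le_of_le_one_right (p.prob_nonneg _ _)
    (mul_le_one₀ (p.prob_le_one _ _) (p.prob_nonneg _ _) (p.prob_le_one _ _)))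

theorem cycleWeight_le_middle (u v : Fin D → I) :
    p.cycleWeight h k l m j u v ≤ p.prob m (Function.update v m (u l)) :=
  (p.cycleWeight_le k l m j u v).trans ((mul_le_of_le_one_left
    (mul_nonneg (p.prob_nonneg _ _) (p.prob_nonneg _ _)) (p.prob_le_one _ _)).trans
    (mul_le_of_le_one_right (p.prob_nonneg _ _) (p.prob_le_one _ _)))

theorem cycleWeight_le_right (u v : Fin D → I) :
    p.cycleWeight h k l m j u v ≤ p.prob j (Function.update v m (u k)) :=
  (p.cycleWeight_le k l m j u v).trans ((mul_le_of_le_one_left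
    (mul_nonneg (p.prob_nonneg _ _) (p.prob_nonneg _ _)) (p.prob_le_one _ _)).trans
    (mul_le_of_le_one_left (p.prob_nonneg _ _) (p.prob_le_one _ _)))

theorem cycleWeight_update (u v : Fin D → I) (y : I) :
    p.cycleWeight h k l m j u (Function.update v m y) = p.cycleWeight h k l m j u v := by
  simp [cycleWeight]

theorem abs_cycleWeight_le (u v : Fin D → I) : |p.cycleWeight h k l m j u v| ≤ 1 := by
  rw [abs_of_nonneg (p.cycleWeight_nonneg k l m j u v)]
  exact (p.cycleWeight_le_left k l m j u v).trans (p.prob_le_one k u)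

theorem integrable_cycleWeight_right (hh : Measurable h) (u : Fin D → I) :
    Integrable (p.cycleWeight h k l m j u) :=
  integrable_of_measurable_of_abs_le ((p.measurable_cycleWeight k l m j hh).comp
    measurable_prodMk_left) fun v => p.abs_cycleWeight_le k l m j u v

end CycleWeight

theorem integral_mem_Icc {α : Type*} [MeasurableSpace α] {μ : Measure α} [IsProbabilityMeasure μ]
    {g : α → ℝ} (hg : Measurable g) {c : ℝ} (h0 : ∀ x, 0 ≤ g x) (hc : ∀ x, g x ≤ c) :
    0 ≤ ∫ x, g x ∂μ ∧ ∫ x, g x ∂μ ≤ c := by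
  refine ⟨integral_nonneg h0, ?_⟩
  have := integral_mono (μ := μ) (integrable_of_measurable_of_abs_le hg (C := c) fun x => by
    rw [abs_of_nonneg (h0 x)]; exact hc x) (integrable_const c) hc
  simpa using this

/-- If every strategy with the law of `p` is deterministic, then cyclic exchanges are impossible. -/
theorem integral_cycleWeight_eq_zero {p : SingleEdgeStrategy D}
    (hp : ∀ q : SingleEdgeStrategy D, q.law = p.law → q.IsDeterministic) {h : I → ℝ}
    (hh : Measurable h) {k l m j : Fin D} (hkl : k ≠ l) (hmj : m ≠ j) :
    ∀ᵐ u : Fin D → I, ∫ v, p.cycleWeight h k l m j u v = 0 := by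
  let w := p.cycleWeight h k l m j
  have hw : Measurable fun z : (Fin D → I) × (Fin D → I) => w z.1 z.2 :=
    p.measurable_cycleWeight k l m j hh
  have hw0 : ∀ u v, 0 ≤ w u v := p.cycleWeight_nonneg k l m j
  let W₁ : (Fin D → I) → ℝ := fun u => ∫ v, w u v
  let W₂ : (Fin D → I) → ℝ := fun v => ∫ u, w (Function.update u l (v m)) v
  let W₃ : (Fin D → I) → ℝ := fun v => ∫ u, w (Function.update u k (v m)) v
  have hm₁ : Measurable W₁ := hw.stronglyMeasurable.integral_prod_right.measurable
  have hwu : ∀ i, Measurable fun z : (Fin D → I) × (Fin D → I) =>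
      w (Function.update z.2 i (z.1 m)) z.1 := fun i =>
    hw.comp (f := fun z : (Fin D → I) × (Fin D → I) => (Function.update z.2 i (z.1 m), z.1))
      (by fun_prop)
  have hm₂ : Measurable W₂ := (hwu l).stronglyMeasurable.integral_prod_right.measurable
  have hm₃ : Measurable W₃ := (hwu k).stronglyMeasurable.integral_prod_right.measurable
  have hb₁ : ∀ u, 0 ≤ W₁ u ∧ W₁ u ≤ p.prob k u := fun u =>
    integral_mem_Icc (hw.comp measurable_prodMk_left) (fun v => hw0 u v)
      fun v => p.cycleWeight_le_left k l m j u v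
  have hb₂ : ∀ v, 0 ≤ W₂ v ∧ W₂ v ≤ p.prob m v := fun v =>
    integral_mem_Icc ((hwu l).comp measurable_prodMk_left) (fun u => hw0 _ v) fun u => by
      simpa using p.cycleWeight_le_middle (h := h) k l m j (Function.update u l (v m)) v
  have hb₃ : ∀ v, 0 ≤ W₃ v ∧ W₃ v ≤ p.prob j v := fun v =>
    integral_mem_Icc ((hwu k).comp measurable_prodMk_left) (fun u => hw0 _ v) fun u => by
      simpa using p.cycleWeight_le_right (h := h) k l m j (Function.update u k (v m)) v
  let d : Fin D → (Fin D → I) → ℝ := fun i u =>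
    4⁻¹ * (moveMass W₁ k l i u + moveMass W₂ m j i u + moveMass W₃ j m i u)
  have hd : ∀ i, Measurable (d i) := fun i =>
    (((measurable_moveMass hm₁ k l i).add (measurable_moveMass hm₂ m j i)).add
      (measurable_moveMass hm₃ j m i)).const_mul _
  have hdsum : ∀ (u : Fin D → I) (x : Fin D → ℝ), ∑ i, d i u * x i
      = 4⁻¹ * (W₁ u * (x l - x k) + W₂ u * (x j - x m) + W₃ u * (x m - x j)) := by
    intro u x
    rw [← sum_moveMass_mul W₁ k l, ← sum_moveMass_mul W₂ m j, ← sum_moveMass_mul W₃ j m,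
      ← Finset.sum_add_distrib, ← Finset.sum_add_distrib, Finset.mul_sum]
    exact Finset.sum_congr rfl fun i _ => by simp only [d]; ring
  have hmove : ∀ (g : (Fin D → I) → ℝ) (a b i : Fin D) (u : Fin D → I), 0 ≤ g u →
      g u ≤ p.prob a u → -p.prob i u ≤ moveMass g a b i u := by
    intro g a b i u h0 h1
    have := p.prob_nonneg i u
    unfold moveMass
    split_ifs with h2 h3 h3
    · linarith
    · linarith
    · subst h3; linarith
    · linarith
  let q := p.perturb d hd (fun u => by simpa using hdsum u 1) (fun i u => by
    have h1 := hmove W₁ k l i u (hb₁ u).1 (hb₁ u).2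
    have h2 := hmove W₂ m j i u (hb₂ u).1 (hb₂ u).2
    have h3 := hmove W₃ j m i u (hb₃ u).1 (hb₃ u).2
    have h4 := p.prob_nonneg i u
    simp only [d]
    linarith)
  have hq : q.law = p.law := by
    refine law_ext fun φ hφ hC => ?_
    have hd_int : ∀ {g : (Fin D → I) → ℝ} (a b : Fin D), Measurable g → (∀ u, 0 ≤ g u ∧ g u ≤ 1) →
        Integrable fun u : Fin D → I => g u * (φ (u a) - φ (u b)) := by
      intro g a b hg hg1
      refine integrable_of_measurable_of_abs_le (C := 1 * (1 + 1)) (by fun_prop) fun u => ?_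
      rw [abs_mul]
      refine mul_le_mul ?_ ((abs_sub _ _).trans (add_le_add (hC _) (hC _))) (abs_nonneg _)
        zero_le_one
      rw [abs_of_nonneg (hg1 u).1]
      exact (hg1 u).2
    have hi₁ := hd_int l k hm₁ fun u => ⟨(hb₁ u).1, (hb₁ u).2.trans (p.prob_le_one _ _)⟩
    have hi₂ := hd_int j m hm₂ fun u => ⟨(hb₂ u).1, (hb₂ u).2.trans (p.prob_le_one _ _)⟩
    have hi₃ := hd_int m j hm₃ fun u => ⟨(hb₃ u).1, (hb₃ u).2.trans (p.prob_le_one _ _)⟩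
    have hsplit : ∀ u : Fin D → I, ∑ i, q.prob i u * φ (u i) = ∑ i, p.prob i u * φ (u i) +
        4⁻¹ * (W₁ u * (φ (u l) - φ (u k)) + W₂ u * (φ (u j) - φ (u m))
          + W₃ u * (φ (u m) - φ (u j))) := by
      intro u
      rw [← hdsum u fun i => φ (u i), ← Finset.sum_add_distrib]
      exact Finset.sum_congr rfl fun i _ => by simp only [q, perturb, add_mul]
    simp_rw [hsplit]
    have hi₁₂ : Integrable fun u : Fin D → I =>
        W₁ u * (φ (u l) - φ (u k)) + W₂ u * (φ (u j) - φ (u m)) := hi₁.add hi₂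
    have hi₁₂₃ : Integrable fun u : Fin D → I => 4⁻¹ * (W₁ u * (φ (u l) - φ (u k))
        + W₂ u * (φ (u j) - φ (u m)) + W₃ u * (φ (u m) - φ (u j))) :=
      (hi₁₂.add hi₃).const_mul _
    rw [integral_add (p.integrable_sum_prob_mul hφ hC) hi₁₂₃,
      integral_const_mul, integral_add hi₁₂ hi₃, integral_add hi₁ hi₂]
    have hbound : ∀ (a b : ℝ) (u v : Fin D → I), |a| ≤ 1 → |b| ≤ 1 →
        |w u v * (a - b)| ≤ 1 * (1 + 1) := by
      intro a b u v ha hb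
      rw [abs_mul]
      exact mul_le_mul (p.abs_cycleWeight_le k l m j u v)
        ((abs_sub _ _).trans (add_le_add ha hb)) (abs_nonneg _) zero_le_one
    have hH : ∀ {a b : (Fin D → I) × (Fin D → I) → I}, Measurable a → Measurable b →
        Integrable (fun z : (Fin D → I) × (Fin D → I) => w z.1 z.2 * (φ (a z) - φ (b z)))
          (volume.prod volume) := fun ha hb =>
      integrable_of_measurable_of_abs_le (hw.mul ((hφ.comp ha).sub (hφ.comp hb)))
        fun z => hbound _ _ _ _ (hC _) (hC _)
    have e₁ : ∫ u, W₁ u * (φ (u l) - φ (u k))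
        = ∫ v, ∫ u, w u v * (φ (u l) - φ (u k)) := by
      simp_rw [W₁, ← integral_mul_const]
      exact integral_integral_swap (hH (a := fun z => z.1 l) (b := fun z => z.1 k)
        (by fun_prop) (by fun_prop))
    have e₂ : ∫ v, W₂ v * (φ (v j) - φ (v m))
        = ∫ v, ∫ u, w u v * (φ (v j) - φ (u l)) := by
      have := integral_integral_update_eq (H := fun u v => w u v * (φ (v j) - φ (u l)))
        (by fun_prop) (fun u v => hbound _ _ u v (hC _) (hC _)) l m fun u v y => by
          simp only [w, cycleWeight_update, Function.update_of_ne hmj.symm]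
      rw [← this]
      simp only [Function.update_self, W₂, integral_mul_const]
    have e₃ : ∫ v, W₃ v * (φ (v m) - φ (v j))
        = ∫ v, ∫ u, w u v * (φ (u k) - φ (v j)) := by
      have := integral_integral_update_eq (H := fun u v => w u v * (φ (u k) - φ (v j)))
        (by fun_prop) (fun u v => hbound _ _ u v (hC _) (hC _)) k m fun u v y => by
          simp only [w, cycleWeight_update, Function.update_of_ne hmj.symm]
      rw [← this]
      simp only [Function.update_self, W₃, integral_mul_const]
    rw [e₁, e₂, e₃]
    have hH₁ := hH (a := fun z => z.1 l) (b := fun z => z.1 k) (by fun_prop) (by fun_prop)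
    have hH₂ := hH (a := fun z => z.2 j) (b := fun z => z.1 l) (by fun_prop) (by fun_prop)
    have hH₃ := hH (a := fun z => z.1 k) (b := fun z => z.2 j) (by fun_prop) (by fun_prop)
    have hH₁₂ : Integrable (fun z : (Fin D → I) × (Fin D → I) =>
        w z.1 z.2 * (φ (z.1 l) - φ (z.1 k)) + w z.1 z.2 * (φ (z.2 j) - φ (z.1 l)))
        (volume.prod volume) := hH₁.add hH₂
    rw [← integral_prod_symm _ hH₁, ← integral_prod_symm _ hH₂, ← integral_prod_symm _ hH₃,
      ← integral_add hH₁ hH₂, ← integral_add hH₁₂ hH₃]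
    have : ∀ z : (Fin D → I) × (Fin D → I), w z.1 z.2 * (φ (z.1 l) - φ (z.1 k))
        + w z.1 z.2 * (φ (z.2 j) - φ (z.1 l)) + w z.1 z.2 * (φ (z.1 k) - φ (z.2 j)) = 0 :=
      fun z => by ring
    simp [this]
  filter_upwards [hp q hq, hp p rfl] with u hqu hpu
  change W₁ u = 0
  have h₁ := hb₁ u
  rcases hpu k with h0 | h1
  · linarith
  have hother : ∀ i, i ≠ k → p.prob i u = 0 := by
    intro i hi
    have h2 := p.sum_prob u
    rw [← Finset.add_sum_erase _ _ (Finset.mem_univ k), h1] at h2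
    have h3 : ∑ i ∈ Finset.univ.erase k, p.prob i u = 0 := by linarith
    exact (Finset.sum_eq_zero_iff_of_nonneg fun i _ => p.prob_nonneg i u).1 h3 i (by simp [hi])
  have hmove' : ∀ (g : (Fin D → I) → ℝ) (a b : Fin D), 0 ≤ g u →
      g u ≤ p.prob a u → a ≠ b → moveMass g a b k u ≤ 0 := by
    intro g a b h0 h2 hab
    unfold moveMass
    split_ifs with h3 h4 h4
    · linarith
    · have := hother a (fun h => h4 h.symm)
      linarith
    · linarith
    · linarith
  have m₁ : moveMass W₁ k l k u = -W₁ u := by simp [moveMass, hkl]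
  have m₂ := hmove' W₂ m j (hb₂ u).1 (hb₂ u).2 hmj
  have m₃ := hmove' W₃ j m (hb₃ u).1 (hb₃ u).2 hmj.symm
  have n₁ := hmove W₁ k l k u (hb₁ u).1 (hb₁ u).2
  have n₂ := hmove W₂ m j k u (hb₂ u).1 (hb₂ u).2
  have n₃ := hmove W₃ j m k u (hb₃ u).1 (hb₃ u).2
  have hqk : q.prob k u = p.prob k u
      + 4⁻¹ * (moveMass W₁ k l k u + moveMass W₂ m j k u + moveMass W₃ j m k u) := rfl
  rcases hqu k with h0 | h0 <;> linarith

theorem isOptimalFor_density {p : SingleEdgeStrategy D}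
    (hp : ∀ q : SingleEdgeStrategy D, q.law = p.law → q.IsDeterministic) :
    p.IsOptimalFor p.density := by
  have hall : ∀ᵐ u : Fin D → I, ∀ k l m j, k ≠ l → m ≠ j →
      ∫ v, p.cycleWeight p.density k l m j u v = 0 := by
    simp only [ae_all_iff]
    intro k l m j hkl hmj
    exact integral_cycleWeight_eq_zero hp p.measurable_density hkl hmj
  filter_upwards [hall] with u hu k l hlt
  by_contra hk
  have hkl : k ≠ l := by rintro rfl; exact lt_irrefl _ hlt
  refine hlt.not_ge (Finset.sum_le_sum fun m _ => ?_)
  have hml : Measurable fun v : Fin D → I => p.prob m (Function.update v m (u l)) :=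
    (p.measurable_prob m).comp (by fun_prop)
  have hmk : ∀ i, Measurable fun v : Fin D → I => p.prob i (Function.update v m (u k)) :=
    fun i => (p.measurable_prob i).comp (by fun_prop)
  have hzero : ∀ᵐ v : Fin D → I, ∀ j, m ≠ j →
      p.prob m (Function.update v m (u l)) * p.prob j (Function.update v m (u k)) = 0 := by
    simp only [ae_all_iff]
    intro j hmj
    have h1 := (integral_eq_zero_iff_of_nonneg (p.cycleWeight_nonneg k l m j u)
      (p.integrable_cycleWeight_right k l m j p.measurable_density u)).1 (hu k l m j hkl hmj)
    filter_upwards [h1] with v hv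
    simpa [cycleWeight, hlt, hk] using hv
  refine integral_mono_ae
    (integrable_of_measurable_of_abs_le hml fun v => p.abs_prob_le_one _ _)
    (integrable_of_measurable_of_abs_le (hmk m) fun v => p.abs_prob_le_one _ _) ?_
  filter_upwards [hzero] with v hv
  have h1 : p.prob m (Function.update v m (u l)) * ∑ j, p.prob j (Function.update v m (u k))
      = p.prob m (Function.update v m (u l)) * p.prob m (Function.update v m (u k)) := by
    rw [Finset.mul_sum, Finset.sum_eq_single m]
    · intro j _ hj
      exact hv j hj.symm
    · simp
  rw [p.sum_prob, mul_one] at h1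
  rw [h1]
  exact mul_le_of_le_one_left (p.prob_nonneg _ _) (p.prob_le_one _ _)

end SingleEdgeStrategy

/-- The uniform distribution on the indices at which `x` is maximal. -/
def maxWeight {ι : Type*} [Fintype ι] (x : ι → ℝ) (k : ι) : ℝ :=
  {x : ι → ℝ | ∀ i, x i ≤ x k}.indicator 1 x / ∑ j, {x : ι → ℝ | ∀ i, x i ≤ x j}.indicator 1 x

section MaxWeight

variable {ι : Type*} [Fintype ι]

theorem measurable_maxWeight (k : ι) : Measurable fun x : ι → ℝ => maxWeight x k := by
  have h : ∀ j, Measurable ({x : ι → ℝ | ∀ i, x i ≤ x j}.indicator (1 : (ι → ℝ) → ℝ)) := by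
    intro j
    refine measurable_one.indicator ?_
    simp only [Set.ofPred_forall]
    exact MeasurableSet.iInter fun i => measurableSet_le (by fun_prop) (by fun_prop)
  exact (h k).div (Finset.measurable_sum _ fun j _ => h j)

theorem maxWeight_nonneg (x : ι → ℝ) (k : ι) : 0 ≤ maxWeight x k :=
  div_nonneg (Set.indicator_nonneg (fun _ _ => zero_le_one) _)
    (Finset.sum_nonneg fun _ _ => Set.indicator_nonneg (fun _ _ => zero_le_one) _)

theorem sum_maxWeight [Nonempty ι] (x : ι → ℝ) : ∑ k, maxWeight x k = 1 := by
  simp only [maxWeight]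
  rw [← Finset.sum_div]
  obtain ⟨k, hk⟩ := Finite.exists_max x
  refine div_self (ne_of_gt ?_)
  refine Finset.sum_pos' (fun _ _ => Set.indicator_nonneg (fun _ _ => zero_le_one) _)
    ⟨k, Finset.mem_univ k, ?_⟩
  rw [Set.indicator_of_mem (by exact hk)]
  exact one_pos

theorem maxWeight_eq_zero {x : ι → ℝ} {k l : ι} (h : x k < x l) : maxWeight x k = 0 := by
  rw [maxWeight, Set.indicator_of_notMem, zero_div]
  exact fun hk => (hk l).not_gt h

theorem maxWeight_const (c : ℝ) (k : ι) :
    maxWeight (fun _ : ι => c) k = (Fintype.card ι : ℝ)⁻¹ := by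
  simp [maxWeight]

end MaxWeight

namespace SingleEdgeStrategy

variable {D : ℕ}

/-- The strategy that chooses uniformly among the labels at which `h` is maximal. -/
def greedy [NeZero D] (h : I → ℝ) (hh : Measurable h) : SingleEdgeStrategy D where
  prob k u := maxWeight (fun i => h (u i)) k
  measurable_prob k := (measurable_maxWeight k).comp (by fun_prop)
  prob_nonneg k u := maxWeight_nonneg _ k
  sum_prob u := sum_maxWeight _

theorem isOptimalFor_greedy [NeZero D] {h : I → ℝ} (hh : Measurable h) :
    (greedy h hh : SingleEdgeStrategy D).IsOptimalFor h :=
  Eventually.of_forall fun _ _ _ hlt => maxWeight_eq_zero hlt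

theorem IsOptimalFor.sum_prob_mul_comp {p q : SingleEdgeStrategy D} {h : I → ℝ}
    (hp : p.IsOptimalFor h) (hq : q.IsOptimalFor h) (ψ : ℝ → ℝ) :
    ∀ᵐ u : Fin D → I, ∑ k, p.prob k u * ψ (h (u k)) = ∑ k, q.prob k u * ψ (h (u k)) := by
  filter_upwards [hp, hq] with u hpu hqu
  have h1 : ∀ k l, p.prob k u * ψ (h (u k)) * q.prob l u
      = q.prob l u * ψ (h (u l)) * p.prob k u := by
    intro k l
    rcases lt_trichotomy (h (u k)) (h (u l)) with hlt | heq | hgt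
    · simp [hpu k l hlt]
    · rw [heq]; ring
    · simp [hqu l k hgt]
  calc ∑ k, p.prob k u * ψ (h (u k))
      = ∑ k, p.prob k u * ψ (h (u k)) * ∑ l, q.prob l u := by simp [q.sum_prob]
    _ = ∑ l, q.prob l u * ψ (h (u l)) * ∑ k, p.prob k u := by
        simp_rw [Finset.mul_sum]
        rw [Finset.sum_comm]
        simp_rw [h1]
    _ = _ := by simp [p.sum_prob]

/-- The advantage of `p` over `q`, written as a sum over pairs of labels. -/
theorem sum_sum_prob_mul_sub (p q : SingleEdgeStrategy D) (h : I → ℝ) (u : Fin D → I) :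
    ∑ k, ∑ l, q.prob k u * p.prob l u * (h (u l) - h (u k))
      = ∑ k, p.prob k u * h (u k) - ∑ k, q.prob k u * h (u k) := by
  have h1 : ∀ k, ∑ l, q.prob k u * p.prob l u * (h (u l) - h (u k))
      = q.prob k u * ∑ l, p.prob l u * h (u l) - q.prob k u * h (u k) * ∑ l, p.prob l u := by
    intro k
    rw [Finset.mul_sum, Finset.mul_sum, ← Finset.sum_sub_distrib]
    exact Finset.sum_congr rfl fun l _ => by ring
  simp_rw [h1, p.sum_prob, mul_one, Finset.sum_sub_distrib, ← Finset.sum_mul, q.sum_prob, one_mul]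

theorem IsOptimalFor.prob_mul_sub_nonneg {p : SingleEdgeStrategy D} {h : I → ℝ} {u : Fin D → I}
    (hp : ∀ k l, h (u k) < h (u l) → p.prob k u = 0) (q : SingleEdgeStrategy D) (k l : Fin D) :
    0 ≤ q.prob k u * p.prob l u * (h (u l) - h (u k)) := by
  rcases le_or_gt (h (u k)) (h (u l)) with hle | hlt
  · exact mul_nonneg (mul_nonneg (q.prob_nonneg _ _) (p.prob_nonneg _ _)) (sub_nonneg.2 hle)
  · simp [hp l k hlt]

theorem IsOptimalFor.sum_prob_mul_le {p : SingleEdgeStrategy D} {h : I → ℝ}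
    (hp : p.IsOptimalFor h) (q : SingleEdgeStrategy D) :
    ∀ᵐ u : Fin D → I, ∑ k, q.prob k u * h (u k) ≤ ∑ k, p.prob k u * h (u k) := by
  filter_upwards [hp] with u hu
  rw [← sub_nonneg, ← sum_sum_prob_mul_sub]
  exact Finset.sum_nonneg fun k _ => Finset.sum_nonneg fun l _ =>
    IsOptimalFor.prob_mul_sub_nonneg hu q k l

theorem IsOptimalFor.integral_law_le {p : SingleEdgeStrategy D} {h : I → ℝ}
    (hp : p.IsOptimalFor h) (hh : Measurable h) {C : ℝ} (hC : ∀ y, |h y| ≤ C)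
    (q : SingleEdgeStrategy D) :
    ∫ y, h y ∂(q.law : Measure I) ≤ ∫ y, h y ∂(p.law : Measure I) := by
  rw [q.integral_law hh hC, p.integral_law hh hC]
  exact integral_mono_ae (q.integrable_sum_prob_mul hh hC) (p.integrable_sum_prob_mul hh hC)
    (hp.sum_prob_mul_le q)

theorem IsOptimalFor.of_integral_law_eq {p q : SingleEdgeStrategy D} {h : I → ℝ}
    (hp : p.IsOptimalFor h) (hh : Measurable h) {C : ℝ} (hC : ∀ y, |h y| ≤ C)
    (hq : ∫ y, h y ∂(q.law : Measure I) = ∫ y, h y ∂(p.law : Measure I)) :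
    q.IsOptimalFor h := by
  rw [q.integral_law hh hC, p.integral_law hh hC] at hq
  have h1 := (integral_eq_iff_of_ae_le (q.integrable_sum_prob_mul hh hC)
    (p.integrable_sum_prob_mul hh hC) (hp.sum_prob_mul_le q)).1 hq
  filter_upwards [hp, h1] with u hu heq k l hlt
  have h2 : ∑ k, ∑ l, q.prob k u * p.prob l u * (h (u l) - h (u k)) = 0 := by
    rw [sum_sum_prob_mul_sub, sub_eq_zero]
    exact heq.symm
  have h3 : ∀ k l, q.prob k u * p.prob l u * (h (u l) - h (u k)) = 0 := by
    intro k l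
    have h4 := (Finset.sum_eq_zero_iff_of_nonneg fun k _ => Finset.sum_nonneg fun l _ =>
      IsOptimalFor.prob_mul_sub_nonneg hu q k l).1 h2 k (Finset.mem_univ k)
    exact (Finset.sum_eq_zero_iff_of_nonneg fun l _ =>
      IsOptimalFor.prob_mul_sub_nonneg hu q k l).1 h4 l (Finset.mem_univ l)
  by_contra hk
  have h5 : ∀ j, p.prob j u = 0 := by
    intro j
    rcases mul_eq_zero.1 (h3 k j) with h6 | h6
    · exact (mul_eq_zero.1 h6).resolve_left hk
    · refine hu j l ?_
      rw [sub_eq_zero.1 h6]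
      exact hlt
  have h6 := p.sum_prob u
  simp [h5] at h6

theorem IsGreedyFor.isOptimalFor {q : SingleEdgeStrategy D} {h : I → ℝ} (hq : q.IsGreedyFor h) :
    q.IsOptimalFor h := by
  filter_upwards [ae_all_iff.2 hq] with u hu k l hlt
  rw [hu k, Set.indicator_of_notMem]
  exact fun hk => (hk l).not_gt hlt

theorem IsOptimalFor.isGreedyFor {q : SingleEdgeStrategy D} {h : I → ℝ} (hq : q.IsOptimalFor h)
    (hh : Measurable h) (hlev : ∀ c, volume {y | h y = c} = 0) : q.IsGreedyFor h := by
  have hne : ∀ᵐ u : Fin D → I, ∀ k l, k ≠ l → h (u k) ≠ h (u l) := by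
    simp only [ae_all_iff]
    exact fun k l hkl => ae_apply_ne_apply hh hlev hkl
  intro k
  filter_upwards [hq, hne] with u hu hneu
  by_cases hk : ∀ i, h (u i) ≤ h (u k)
  · rw [Set.indicator_of_mem (by exact hk), Pi.one_apply, ← q.sum_prob u, Finset.sum_eq_single k]
    · intro l _ hl
      exact hu l k (lt_of_le_of_ne (hk l) (hneu l k hl))
    · simp
  · rw [Set.indicator_of_notMem (by exact hk)]
    push Not at hk
    obtain ⟨l, hl⟩ := hk
    exact hu k l hl

theorem IsGreedyFor.law_eq {p q : SingleEdgeStrategy D} {h : I → ℝ} (hp : p.IsGreedyFor h)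
    (hq : q.IsGreedyFor h) : p.law = q.law :=
  law_eq_of_prob_ae_eq fun k => by
    filter_upwards [hp k, hq k] with u h1 h2
    rw [h1, h2]

/-- The density of the uniform greedy strategy for `h` is a function of `h`. -/
theorem exists_density_greedy_eq_comp [NeZero D] {h : I → ℝ} (hh : Measurable h) :
    ∃ G : ℝ → ℝ, Measurable G ∧
      ∀ y, (greedy h hh : SingleEdgeStrategy D).density y = G (h y) := by
  refine ⟨fun t => ∑ k : Fin D, ∫ u : Fin D → I,
    maxWeight (Function.update (fun i => h (u i)) k t) k, ?_, fun y => ?_⟩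
  · refine Finset.measurable_sum _ fun k _ => ?_
    have : StronglyMeasurable fun z : ℝ × (Fin D → I) =>
        maxWeight (Function.update (fun i => h (z.2 i)) k z.1) k :=
      ((measurable_maxWeight k).comp (by fun_prop)).stronglyMeasurable
    exact this.integral_prod_right.measurable
  · simp only [density, greedy]
    refine Finset.sum_congr rfl fun k _ => ?_
    congr 1
    ext u
    congr 1
    exact Function.comp_update h u k y

theorem law_greedy_density [NeZero D] {p : SingleEdgeStrategy D}
    (hp : p.IsOptimalFor p.density) :
    (greedy p.density p.measurable_density : SingleEdgeStrategy D).law = p.law := by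
  set q : SingleEdgeStrategy D := greedy p.density p.measurable_density with hqdef
  obtain ⟨G, hG, hGq⟩ := exists_density_greedy_eq_comp (D := D) p.measurable_density
  rw [law_eq_iff_density_ae_eq]
  let ψ : ℝ → ℝ := fun t => if t ≤ G t then 1 else -1
  have hψ : Measurable ψ := Measurable.ite (measurableSet_le measurable_id hG)
    measurable_const measurable_const
  have hψ1 : ∀ t, |ψ t| ≤ 1 := fun t => by simp only [ψ]; split_ifs <;> simp
  have hφ : Measurable fun y => ψ (p.density y) := hψ.comp p.measurable_density
  have h1 := integral_congr_ae ((isOptimalFor_greedy p.measurable_density).sum_prob_mul_comp hp ψ)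
  rw [← hqdef, q.integral_sum_prob_mul hφ fun y => hψ1 _,
    p.integral_sum_prob_mul hφ fun y => hψ1 _] at h1
  have hint : ∀ r : SingleEdgeStrategy D, Integrable fun y => ψ (p.density y) * r.density y :=
    fun r => integrable_of_measurable_of_abs_le (hφ.mul r.measurable_density) (C := 1 * D)
      fun y => by
        rw [abs_mul]
        exact mul_le_mul (hψ1 _) (r.abs_density_le y) (abs_nonneg _) zero_le_one
  have h2 : ∫ y, |q.density y - p.density y| = 0 := by
    rw [← sub_eq_zero.2 h1, ← integral_sub (hint q) (hint p)]
    congr 1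
    ext y
    rw [← mul_sub]
    simp only [ψ, hqdef, hGq]
    split_ifs with h3
    · rw [one_mul, abs_of_nonneg (sub_nonneg.2 h3)]
    · rw [neg_one_mul, abs_of_neg (sub_neg.2 (not_le.1 h3))]
  have hi : Integrable fun y => |q.density y - p.density y| :=
    (q.integrable_density.sub p.integrable_density).abs
  rw [integral_eq_zero_iff_of_nonneg (fun y => abs_nonneg _) hi] at h2
  filter_upwards [h2] with y hy
  exact sub_eq_zero.1 (abs_eq_zero.1 hy)

/-- If every strategy with the law of `p` is deterministic, then the density of that law has no
level sets of positive measure. -/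
theorem volume_density_eq_const [NeZero D] (hD : 2 ≤ D) {p : SingleEdgeStrategy D}
    (hp : ∀ q : SingleEdgeStrategy D, q.law = p.law → q.IsDeterministic) (c : ℝ) :
    volume {y : I | p.density y = c} = 0 := by
  by_contra hc
  have hdet := hp _ (law_greedy_density (isOptimalFor_density hp))
  have hpos : volume (Set.univ.pi fun _ : Fin D => {y : I | p.density y = c}) ≠ 0 := by
    rw [volume_pi, Measure.pi_pi]
    exact Finset.prod_ne_zero_iff.2 fun _ _ => hc
  obtain ⟨u, hu1, hu2⟩ := (frequently_ae_mem_iff.2 hpos).and_eventually hdet |>.exists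
  have hu : (fun i => p.density (u i)) = fun _ => c := by
    ext i; exact hu1 i (Set.mem_univ i)
  have h3 := hu2 0
  simp only [greedy, hu, maxWeight_const, Fintype.card_fin] at h3
  have h4 : (2 : ℝ) ≤ D := by exact_mod_cast hD
  rcases h3 with h3 | h3
  · rw [inv_eq_zero] at h3; linarith
  · rw [inv_eq_one] at h3; linarith

theorem IsGreedyFor.density_ae_eq {q : SingleEdgeStrategy D} {h : I → ℝ} (hh : Measurable h)
    (hq : q.IsGreedyFor h) :
    ∀ᵐ y : I, q.density y = D * cdf ((volume : Measure I).map h) (h y) ^ (D - 1) := by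
  have : IsProbabilityMeasure ((volume : Measure I).map h) :=
    Measure.isProbabilityMeasure_map hh.aemeasurable
  filter_upwards [ae_all_iff.2 fun k => ae_ae_update (hq k) k] with y hy
  have key : ∀ k, ∫ u : Fin D → I, q.prob k (Function.update u k y)
      = cdf ((volume : Measure I).map h) (h y) ^ (D - 1) := by
    intro k
    let A : Set I := h ⁻¹' Set.Iic (h y)
    have hA : MeasurableSet A := hh measurableSet_Iic
    let s : Fin D → Set I := Function.update (fun _ => A) k Set.univ
    have hs : ∀ i, MeasurableSet (s i) := by
      intro i
      by_cases hi : i = k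
      · subst hi; simp [s]
      · simpa [s, hi] using hA
    have h1 : ∀ᵐ u : Fin D → I, q.prob k (Function.update u k y)
        = (Set.univ.pi s).indicator 1 u := by
      filter_upwards [hy k] with u hu
      rw [hu]
      have : Function.update u k y ∈ {v : Fin D → I | ∀ i, h (v i) ≤ h (v k)}
          ↔ u ∈ Set.univ.pi s := by
        simp only [Set.mem_ofPred_eq, Set.mem_pi, Set.mem_univ, true_imp_iff, Function.update_self]
        refine forall_congr' fun i => ?_
        by_cases hi : i = k
        · subst hi; simp [s]
        · simp [s, hi, A]
      by_cases hm : u ∈ Set.univ.pi s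
      · rw [Set.indicator_of_mem hm, Set.indicator_of_mem (this.2 hm)]; rfl
      · rw [Set.indicator_of_notMem hm, Set.indicator_of_notMem (mt this.1 hm)]
    rw [integral_congr_ae h1, integral_indicator_one (MeasurableSet.univ_pi hs), Measure.real,
      volume_pi, Measure.pi_pi, ← Finset.mul_prod_erase Finset.univ _ (Finset.mem_univ k)]
    have h2 : ∏ i ∈ Finset.univ.erase k, volume (s i) = volume A ^ (D - 1) := by
      rw [Finset.prod_congr rfl (g := fun _ => volume A), Finset.prod_const,
        Finset.card_erase_of_mem (Finset.mem_univ k), Finset.card_univ, Fintype.card_fin]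
      intro i hi
      simp [s, Finset.ne_of_mem_erase hi]
    rw [h2, cdf_eq_real, map_measureReal_apply hh measurableSet_Iic]
    simp [s, A, Measure.real]
  simp only [density, key]
  simp

end SingleEdgeStrategy

/-- The distribution function of a measure without atoms, evaluated at a random point, is uniform
on `[0,1]`. -/
theorem map_cdf_eq_volume (μ : Measure ℝ) [IsProbabilityMeasure μ] (hμ : ∀ x, μ {x} = 0) :
    μ.map (fun x => (⟨cdf μ x, cdf_nonneg μ x, cdf_le_one μ x⟩ : I)) = volume := by
  have : NullSingletonClass μ := ⟨hμ⟩
  have hmeas : Measurable (fun x => (⟨cdf μ x, cdf_nonneg μ x, cdf_le_one μ x⟩ : I)) :=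
    (monotone_cdf μ).measurable.subtype_mk
  have : IsProbabilityMeasure (μ.map (fun x => (⟨cdf μ x, cdf_nonneg μ x, cdf_le_one μ x⟩ : I))) :=
    Measure.isProbabilityMeasure_map hmeas.aemeasurable
  have hcont : Continuous (cdf μ) := by
    rw [continuous_iff_continuousAt]
    intro x
    rw [(monotone_cdf μ).continuousAt_iff_leftLim_eq_rightLim, (cdf μ).rightLim_eq]
    have h1 : (cdf μ).measure {x} = 0 := by rw [measure_cdf, hμ]
    rw [StieltjesFunction.measure_singleton, ENNReal.ofReal_eq_zero, sub_nonpos] at h1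
    exact le_antisymm ((monotone_cdf μ).leftLim_le le_rfl) h1
  have hsurj : ∀ t : ℝ, 0 < t → t < 1 → ∃ x, cdf μ x = t := by
    intro t h0 h1
    have e1 := ((tendsto_cdf_atBot μ).eventually (ge_mem_nhds h0)).exists
    have e2 := ((tendsto_cdf_atTop μ).eventually (le_mem_nhds h1)).exists
    exact mem_range_of_exists_le_of_exists_ge hcont e1 e2
  refine Measure.ext_of_Iic _ _ fun t => ?_
  rw [Measure.map_apply hmeas measurableSet_Iic, unitInterval.volume_Iic]
  have hset : (fun x => (⟨cdf μ x, cdf_nonneg μ x, cdf_le_one μ x⟩ : I)) ⁻¹' Set.Iic t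
      = {x | cdf μ x ≤ t} := rfl
  rw [hset, ← ofReal_measureReal]
  congr 1
  refine le_antisymm ?_ ?_
  · refine le_of_forall_gt_imp_ge_of_dense fun s hs => ?_
    rcases lt_or_ge s 1 with hs1 | hs1
    · obtain ⟨x, hx⟩ := hsurj s (t.2.1.trans_lt hs) hs1
      rw [← hx, cdf_eq_real]
      refine measureReal_mono fun z hz => ?_
      by_contra hlt
      have := monotone_cdf μ (not_le.1 hlt).le
      rw [hx] at this
      exact (this.trans hz).not_gt hs
    · exact measureReal_le_one.trans hs1
  · rcases t.2.1.eq_or_lt with h0 | h0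
    · rw [← h0]; exact measureReal_nonneg
    rcases t.2.2.eq_or_lt with h1 | h1
    · have : {x | cdf μ x ≤ t} = Set.univ := by
        ext x; simp [h1, cdf_le_one]
      rw [this, h1]; simp
    · obtain ⟨x, hx⟩ := hsurj t h0 h1
      rw [← hx, cdf_eq_real]
      exact measureReal_mono fun z hz => by
        rw [Set.mem_ofPred_eq, ← cdf_eq_real]
        exact monotone_cdf μ hz

section MaxDensity

variable {D : ℕ}

theorem measurable_maxDensity : Measurable (maxDensity D) := by
  unfold maxDensity; fun_prop

theorem maxDensity_le_maxDensity_iff (hD : 2 ≤ D) {x y : I} :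
    maxDensity D x ≤ maxDensity D y ↔ x ≤ y := by
  have h1 : (0 : ℝ) < D := by positivity
  rw [maxDensity, maxDensity, mul_le_mul_iff_right₀ h1, ← Subtype.coe_le_coe,
    pow_le_pow_iff_left₀ x.2.1 y.2.1 (by lia)]

theorem volume_maxDensity_eq_const (hD : 2 ≤ D) (c : ℝ) :
    volume {y : I | maxDensity D y = c} = 0 :=
  Set.Subsingleton.measure_zero (fun _ hx _ hy => le_antisymm
    ((maxDensity_le_maxDensity_iff hD).1 (hx.trans hy.symm).le)
    ((maxDensity_le_maxDensity_iff hD).1 (hy.trans hx.symm).le)) _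

theorem cdf_map_maxDensity (hD : 2 ≤ D) (y : I) :
    cdf ((volume : Measure I).map (maxDensity D)) (maxDensity D y) = y := by
  have : IsProbabilityMeasure ((volume : Measure I).map (maxDensity D)) :=
    Measure.isProbabilityMeasure_map measurable_maxDensity.aemeasurable
  rw [cdf_eq_real, map_measureReal_apply measurable_maxDensity measurableSet_Iic]
  have : maxDensity D ⁻¹' Set.Iic (maxDensity D y) = Set.Iic y := by
    ext x
    exact maxDensity_le_maxDensity_iff hD
  rw [this, Measure.real, unitInterval.volume_Iic, ENNReal.toReal_ofReal y.2.1]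

theorem betaPDF_one_right {a : ℝ} (ha : 0 < a) {x : ℝ} (h0 : 0 < x) (h1 : x < 1) :
    betaPDF a 1 x = ENNReal.ofReal (a * x ^ (a - 1)) := by
  rw [betaPDF_of_pos_lt_one h0 h1, beta, Real.Gamma_add_one ha.ne', Real.Gamma_one]
  have := (Real.Gamma_pos_of_pos ha).ne'
  congr 1
  field_simp
  simp

theorem betaMeasure_one_right_Iic {a : ℝ} (ha : 0 < a) {t : ℝ} (h0 : 0 < t) (h1 : t < 1) :
    betaMeasure a 1 (Set.Iic t) = ENNReal.ofReal (t ^ a) := by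
  rw [betaMeasure, withDensity_apply _ measurableSet_Iic]
  have hsplit : Set.Iic t = Set.Iic 0 ∪ Set.Ioc 0 t := (Set.Iic_union_Ioc_eq_Iic h0.le).symm
  have hdisj : Disjoint (Set.Iic 0) (Set.Ioc 0 t) :=
    Set.disjoint_left.2 fun _ hx hx' => (not_lt.2 hx) hx'.1
  rw [hsplit, lintegral_union measurableSet_Ioc hdisj,
    setLIntegral_eq_zero measurableSet_Iic (fun x hx => betaPDF_eq_zero_of_nonpos hx), zero_add,
    setLIntegral_congr_fun measurableSet_Ioc
      fun x hx => betaPDF_one_right ha hx.1 (hx.2.trans_lt h1)]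
  have hii : IntervalIntegrable (fun x : ℝ => a * x ^ (a - 1)) volume 0 t :=
    (intervalIntegral.intervalIntegrable_rpow' (by linarith)).const_mul _
  rw [← ofReal_integral_eq_lintegral_ofReal hii.1, ← intervalIntegral.integral_of_le h0.le,
    intervalIntegral.integral_const_mul, integral_rpow (Or.inl (by linarith))]
  · congr 1
    rw [sub_add_cancel, Real.zero_rpow ha.ne', sub_zero, mul_div_cancel₀ _ ha.ne']
  · exact (ae_restrict_iff' measurableSet_Ioc).2 (Eventually.of_forall fun x hx =>
      mul_nonneg ha.le (Real.rpow_nonneg hx.1.le _))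

theorem map_maxDensity_div (hD : 2 ≤ D) :
    (volume : Measure I).map (fun y => maxDensity D y / D)
      = betaMeasure (1 / ((D : ℝ) - 1)) 1 := by
  have hD' : (2 : ℝ) ≤ D := by exact_mod_cast hD
  have ha : 0 < 1 / ((D : ℝ) - 1) := one_div_pos.2 (by linarith)
  have hm : Measurable fun y => maxDensity D y / D := measurable_maxDensity.div_const _
  have := isProbabilityMeasureBeta ha one_pos
  have : IsProbabilityMeasure ((volume : Measure I).map (fun y => maxDensity D y / D)) :=
    Measure.isProbabilityMeasure_map hm.aemeasurable
  have hval : ∀ y : I, maxDensity D y / D = (y : ℝ) ^ (D - 1) := fun y => by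
    rw [maxDensity, mul_div_cancel_left₀]; positivity
  refine Measure.ext_of_Iic _ _ fun t => ?_
  rw [Measure.map_apply hm measurableSet_Iic]
  rcases le_or_gt t 0 with ht | ht
  · have h1 : betaMeasure (1 / ((D : ℝ) - 1)) 1 (Set.Iic t) = 0 := by
      rw [betaMeasure, withDensity_apply _ measurableSet_Iic]
      exact setLIntegral_eq_zero measurableSet_Iic fun x hx =>
        betaPDF_eq_zero_of_nonpos (le_trans hx ht)
    rw [h1]
    refine Set.Subsingleton.measure_zero (s := (fun y : I => maxDensity D y / D) ⁻¹' Set.Iic t)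
      ?_ _
    have h2 : ∀ y : I, y ∈ (fun y : I => maxDensity D y / D) ⁻¹' Set.Iic t → y = 0 := by
      intro y hy
      rw [Set.mem_preimage, hval] at hy
      have h3 : (y : ℝ) ^ (D - 1) = 0 := le_antisymm (le_trans hy ht) (pow_nonneg y.2.1 _)
      exact Subtype.ext (pow_eq_zero_iff (by lia) |>.1 h3)
    intro x hx y hy
    rw [h2 x hx, h2 y hy]
  rcases le_or_gt 1 t with ht1 | ht1
  · have h1 : (fun y : I => maxDensity D y / D) ⁻¹' Set.Iic t = Set.univ := by
      ext y
      simp only [Set.mem_preimage, hval, Set.mem_Iic, Set.mem_univ, iff_true]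
      exact (pow_le_one₀ y.2.1 y.2.2).trans ht1
    have h2 : betaMeasure (1 / ((D : ℝ) - 1)) 1 (Set.Iic t)ᶜ = 0 := by
      rw [betaMeasure, withDensity_apply _ measurableSet_Iic.compl]
      refine setLIntegral_eq_zero measurableSet_Iic.compl fun x hx => ?_
      exact betaPDF_eq_zero_of_one_le (ht1.trans (not_le.1 (show ¬ x ≤ t from hx)).le)
    rw [h1, measure_univ, (prob_compl_eq_zero_iff measurableSet_Iic).1 h2]
  · rw [betaMeasure_one_right_Iic ha ht ht1]
    have hs : t ^ (1 / ((D : ℝ) - 1)) ∈ I :=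
      ⟨Real.rpow_nonneg ht.le _, Real.rpow_le_one ht.le ht1.le ha.le⟩
    have h1 : (fun y : I => maxDensity D y / D) ⁻¹' Set.Iic t = Set.Iic ⟨_, hs⟩ := by
      ext y
      simp only [Set.mem_preimage, hval, Set.mem_Iic, ← Subtype.coe_le_coe]
      have h2 : (t ^ (1 / ((D : ℝ) - 1))) ^ (D - 1) = t := by
        rw [← Real.rpow_natCast, ← Real.rpow_mul ht.le, Nat.cast_sub (by lia), Nat.cast_one,
          one_div_mul_cancel (by linarith), Real.rpow_one]
      rw [← pow_le_pow_iff_left₀ y.2.1 hs.1 (by lia : D - 1 ≠ 0), h2]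
    rw [h1, unitInterval.volume_Iic]

theorem map_div_eq_beta_iff (hD : 2 ≤ D) {f : I → ℝ} (hf : Measurable f) :
    (volume : Measure I).map (fun y => f y / D) = betaMeasure (1 / ((D : ℝ) - 1)) 1 ↔
      (volume : Measure I).map f = (volume : Measure I).map (maxDensity D) := by
  have h0 : (D : ℝ) ≠ 0 := by positivity
  have hdiv : Measurable fun x : ℝ => x / (D : ℝ) := measurable_id.div_const _
  have hmul : Measurable fun x : ℝ => x * (D : ℝ) := measurable_id.mul_const _
  have hcomp : ∀ {g : I → ℝ}, Measurable g → (volume : Measure I).map (fun y => g y / D)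
      = ((volume : Measure I).map g).map (fun x => x / (D : ℝ)) := fun hg => by
    rw [Measure.map_map hdiv hg]; rfl
  rw [← map_maxDensity_div hD, hcomp hf, hcomp measurable_maxDensity]
  refine ⟨fun h => ?_, fun h => by rw [h]⟩
  have h1 := congrArg (fun μ : Measure ℝ => μ.map fun x => x * (D : ℝ)) h
  have h2 : ((fun x : ℝ => x * (D : ℝ)) ∘ fun x => x / D) = id := by
    ext x; simp [h0]
  rwa [Measure.map_map hmul hdiv, Measure.map_map hmul hdiv, h2, Measure.map_id,
    Measure.map_id] at h1

end MaxDensity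

namespace SingleEdgeStrategy

variable {D : ℕ}

theorem IsGreedyFor.map_density {q : SingleEdgeStrategy D} {h : I → ℝ} (hq : q.IsGreedyFor h)
    (hh : Measurable h) (hlev : ∀ c, volume {y | h y = c} = 0) :
    (volume : Measure I).map q.density = (volume : Measure I).map (maxDensity D) := by
  set μ := (volume : Measure I).map h with hμ
  have : IsProbabilityMeasure μ := Measure.isProbabilityMeasure_map hh.aemeasurable
  have hatom : ∀ x, μ {x} = 0 := fun x => by
    rw [hμ, Measure.map_apply hh (measurableSet_singleton x)]
    exact hlev x
  have hF : Measurable (fun x => (⟨cdf μ x, cdf_nonneg μ x, cdf_le_one μ x⟩ : I)) :=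
    (monotone_cdf μ).measurable.subtype_mk
  rw [Measure.map_congr (hq.density_ae_eq hh)]
  conv_rhs => rw [← map_cdf_eq_volume μ hatom, hμ, Measure.map_map hF hh,
    Measure.map_map measurable_maxDensity (hF.comp hh)]
  rfl

theorem volume_density_eq_const_of_map_eq (hD : 2 ≤ D) {f : I → ℝ} (hf : Measurable f)
    (hmap : (volume : Measure I).map f = (volume : Measure I).map (maxDensity D)) (c : ℝ) :
    volume {y : I | f y = c} = 0 := by
  have h1 := congrArg (fun μ : Measure ℝ => μ {c}) hmap
  simp only [Measure.map_apply hf (measurableSet_singleton c),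
    Measure.map_apply measurable_maxDensity (measurableSet_singleton c)] at h1
  exact h1.trans (volume_maxDensity_eq_const hD c)

/-- A law whose density is a rearrangement of `f_MAX` is achieved by the greedy strategy. -/
theorem law_eq_of_isGreedyFor_density (hD : 2 ≤ D) {p q : SingleEdgeStrategy D}
    (hmap : (volume : Measure I).map p.density = (volume : Measure I).map (maxDensity D))
    (hq : q.IsGreedyFor p.density) : q.law = p.law := by
  rw [law_eq_iff_density_ae_eq]
  have h1 : ∀ᵐ t ∂(volume : Measure I).map (maxDensity D),
      D * cdf ((volume : Measure I).map (maxDensity D)) t ^ (D - 1) = t := by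
    rw [ae_map_iff measurable_maxDensity.aemeasurable]
    · refine Eventually.of_forall fun y => ?_
      rw [cdf_map_maxDensity hD]; rfl
    · exact measurableSet_eq_fun (((monotone_cdf _).measurable.pow_const _).const_mul _)
        measurable_id
  rw [← hmap] at h1
  filter_upwards [hq.density_ae_eq p.measurable_density,
    ae_of_ae_map p.measurable_density.aemeasurable h1] with y h2 h3
  rw [h2, h3]

theorem mem_extremePoints_of_isGreedyFor {p q : SingleEdgeStrategy D} {h : I → ℝ}
    (hh : Measurable h) {C : ℝ} (hC : ∀ y, |h y| ≤ C) (hlev : ∀ c, volume {y | h y = c} = 0)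
    (hq : q.IsGreedyFor h) (hlaw : q.law = p.law) :
    p.law ∈ Set.extremePoints ℝ≥0 (achievableLaws D) := by
  refine ⟨⟨p, rfl⟩, ?_⟩
  rintro _ ⟨p₁, rfl⟩ _ ⟨p₂, rfl⟩ ⟨a, b, ha, hb, hab, hp⟩
  have h1 := hq.isOptimalFor.integral_law_le hh hC p₁
  have h2 := hq.isOptimalFor.integral_law_le hh hC p₂
  have hab' : (a : ℝ) + b = 1 := by exact_mod_cast hab
  have ha' : (0 : ℝ) < a := ha
  have hb' : (0 : ℝ) < b := hb
  have hmix : ∫ y, h y ∂(q.law : Measure I)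
      = a * ∫ y, h y ∂(p₁.law : Measure I) + b * ∫ y, h y ∂(p₂.law : Measure I) := by
    rw [hlaw, ← hp]
    have e1 : ((a • p₁.law + b • p₂.law : FiniteMeasure I) : Measure I)
        = a • (p₁.law : Measure I) + b • (p₂.law : Measure I) := rfl
    rw [e1, integral_add_measure, integral_smul_nnreal_measure, integral_smul_nnreal_measure]
    · simp [NNReal.smul_def]
    · exact (integrable_of_measurable_of_abs_le hh hC).smul_measure_nnreal
    · exact (integrable_of_measurable_of_abs_le hh hC).smul_measure_nnreal
  have h3 : ∫ y, h y ∂(p₁.law : Measure I) = ∫ y, h y ∂(q.law : Measure I) := by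
    refine le_antisymm h1 (not_lt.1 fun hlt => ?_)
    have e1 := mul_pos ha' (sub_pos.2 hlt)
    have e2 := mul_nonneg hb'.le (sub_nonneg.2 h2)
    have e3 : (a : ℝ) * ∫ y, h y ∂(q.law : Measure I) + b * ∫ y, h y ∂(q.law : Measure I)
        = ∫ y, h y ∂(q.law : Measure I) := by rw [← add_mul, hab', one_mul]
    linarith
  have h4 := (hq.isOptimalFor.of_integral_law_eq hh hC h3).isGreedyFor hh hlev
  rw [h4.law_eq hq, hlaw]

theorem tfae_extreme_consistent_greedy_beta_map (hD : 2 ≤ D) (p : SingleEdgeStrategy D) :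
    List.TFAE [
      p.law ∈ Set.extremePoints ℝ≥0 (achievableLaws D),
      ∀ q : SingleEdgeStrategy D, q.IsConsistent → q.law = p.law → q.IsDeterministic,
      (∀ c : ℝ, volume {y : I | p.density y = c} = 0) ∧
        ∃ q : SingleEdgeStrategy D, q.IsGreedyFor p.density ∧ q.law = p.law,
      (volume : Measure I).map (fun y => p.density y / D) = betaMeasure (1 / ((D : ℝ) - 1)) 1,
      (volume : Measure I).map p.density = (volume : Measure I).map (maxDensity D)] := by
  have : NeZero D := ⟨by lia⟩
  have hdet : p.law ∈ Set.extremePoints ℝ≥0 (achievableLaws D) →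
      ∀ q : SingleEdgeStrategy D, q.law = p.law → q.IsDeterministic := fun h q hq =>
    isDeterministic_of_mem_extremePoints (hq ▸ h)
  tfae_have 1 → 2 := fun h q _ hq => hdet h q hq
  tfae_have 2 → 1 := mem_extremePoints_of_forall_isConsistent
  tfae_have 1 → 3 := fun h =>
    have hlev := volume_density_eq_const hD (hdet h)
    ⟨hlev, p, (isOptimalFor_density (hdet h)).isGreedyFor p.measurable_density hlev, rfl⟩
  tfae_have 3 → 5 := fun ⟨hlev, q, hq, hlaw⟩ => by
    rw [← Measure.map_congr (law_eq_iff_density_ae_eq.1 hlaw)]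
    exact hq.map_density p.measurable_density hlev
  tfae_have 5 → 1 := fun h => by
    have hlev := volume_density_eq_const_of_map_eq hD p.measurable_density h
    have hq := (isOptimalFor_greedy (D := D) p.measurable_density).isGreedyFor
      p.measurable_density hlev
    exact mem_extremePoints_of_isGreedyFor p.measurable_density p.abs_density_le hlev hq
      (law_eq_of_isGreedyFor_density hD h hq)
  tfae_have 4 ↔ 5 := map_div_eq_beta_iff hD p.measurable_density
  tfae_finish

end SingleEdgeStrategy

/-- The `m`-th moment of a measure on `[0,1]`. -/
def powerMoment (μ : Measure I) (m : ℕ) : ℝ := ∫ y, (y : ℝ) ^ m ∂μ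

theorem abs_coe_pow_le_one (m : ℕ) (y : I) : |(y : ℝ) ^ m| ≤ 1 := by
  rw [abs_of_nonneg (pow_nonneg y.2.1 m)]
  exact pow_le_one₀ y.2.1 y.2.2

theorem integrable_coe_pow (μ : Measure I) [IsFiniteMeasure μ] (m : ℕ) :
    Integrable (fun y : I => (y : ℝ) ^ m) μ :=
  integrable_of_measurable_of_abs_le (by fun_prop) (abs_coe_pow_le_one m)

theorem integral_polynomial_eval (μ : Measure I) [IsFiniteMeasure μ] (P : Polynomial ℝ) :
    ∫ y, P.eval (y : ℝ) ∂μ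
      = ∑ m ∈ Finset.range (P.natDegree + 1), P.coeff m * powerMoment μ m := by
  simp_rw [Polynomial.eval_eq_sum_range, powerMoment, ← integral_const_mul]
  exact integral_finsetSum _ fun m _ => (integrable_coe_pow μ m).const_mul _

/-- Convergence of moments on `[0,1]` implies convergence of the integrals of continuous
functions. -/
theorem tendsto_integral_of_tendsto_powerMoment {μ : ℕ → Measure I} {ν : Measure I}
    [∀ n, IsProbabilityMeasure (μ n)] [IsProbabilityMeasure ν]
    (h : ∀ m, Tendsto (fun n => powerMoment (μ n) m) atTop (𝓝 (powerMoment ν m)))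
    (f : BoundedContinuousFunction I ℝ) :
    Tendsto (fun n => ∫ y, f y ∂(μ n)) atTop (𝓝 (∫ y, f y ∂ν)) := by
  rw [Metric.tendsto_atTop]
  intro ε hε
  obtain ⟨P, hP⟩ := exists_polynomial_near_continuousMap 0 1 (f.toContinuousMap : C(I, ℝ)) (ε / 3)
    (by positivity)
  have hPf : ∀ y : I, ‖f y - P.eval (y : ℝ)‖ ≤ ε / 3 := fun y => by
    have := (ContinuousMap.norm_lt_iff _ (by positivity)).1 hP y
    rw [norm_sub_rev]
    exact this.le
  have hPi : ∀ (κ : Measure I) [IsProbabilityMeasure κ],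
      Integrable (fun y : I => P.eval (y : ℝ)) κ := fun κ _ => by
    simp_rw [Polynomial.eval_eq_sum_range]
    exact integrable_finsetSum _ fun m _ => (integrable_coe_pow κ m).const_mul _
  have hclose : ∀ (κ : Measure I) [IsProbabilityMeasure κ],
      |∫ y, f y ∂κ - ∫ y, P.eval (y : ℝ) ∂κ| ≤ ε / 3 := fun κ _ => by
    rw [← integral_sub (f.integrable κ) (hPi κ)]
    simpa using norm_integral_le_of_norm_le_const (μ := κ) (Eventually.of_forall hPf)
  have hPlim : Tendsto (fun n => ∫ y, P.eval (y : ℝ) ∂(μ n)) atTop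
      (𝓝 (∫ y, P.eval (y : ℝ) ∂ν)) := by
    simp_rw [integral_polynomial_eval]
    exact tendsto_finsetSum _ fun m _ => (h m).const_mul _
  obtain ⟨N, hN⟩ := Metric.tendsto_atTop.1 hPlim (ε / 3) (by positivity)
  refine ⟨N, fun n hn => ?_⟩
  have h1 := hN n hn
  have h2 := hclose (μ n)
  have h3 := hclose ν
  rw [Real.dist_eq, abs_lt] at *
  rw [abs_le] at h2 h3
  constructor <;> linarith [h1.1, h1.2, h2.1, h2.2, h3.1, h3.2]

/-- The moments up to order `M` of two measures differ by less than `1 / (M + 1)`. -/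
def MomentsClose (M : ℕ) (a b : ℕ → ℝ) : Prop := ∀ m ≤ M, |a m - b m| < 1 / ((M : ℝ) + 1)

theorem tendsto_of_forall_momentsClose {a : ℕ → ℕ → ℝ} {b : ℕ → ℝ}
    (h : ∀ M, MomentsClose M (a M) b) (m : ℕ) : Tendsto (fun n => a n m) atTop (𝓝 (b m)) := by
  rw [tendsto_iff_dist_tendsto_zero]
  refine squeeze_zero' (Eventually.of_forall fun _ => dist_nonneg)
    ((eventually_ge_atTop m).mono fun n hn => ?_) tendsto_one_div_add_atTop_nhds_zero_nat
  exact (h n m hn).le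

theorem levyProkhorovEDist_le_of_momentsClose (ν : Measure I) [IsProbabilityMeasure ν]
    {δ : ℝ≥0∞} (hδ : 0 < δ) : ∃ M, ∀ (μ : Measure I) [IsProbabilityMeasure μ],
      MomentsClose M (powerMoment μ) (powerMoment ν) → levyProkhorovEDist μ ν ≤ δ := by
  by_contra! hcon
  choose μ hμ hclose hfar using hcon
  let μ' : ℕ → ProbabilityMeasure I := fun n => ⟨μ n, hμ n⟩
  let ν' : ProbabilityMeasure I := ⟨ν, inferInstance⟩
  have hw : Tendsto μ' atTop (𝓝 ν') :=
    ProbabilityMeasure.tendsto_iff_forall_integral_tendsto.2 fun f =>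
      tendsto_integral_of_tendsto_powerMoment (tendsto_of_forall_momentsClose hclose) f
  have hLP := ((LevyProkhorov.continuous_ofMeasure_probabilityMeasure (Ω := I)).tendsto _).comp hw
  obtain ⟨n, hn⟩ := ((tendsto_iff_edist_tendsto_0.1 hLP).eventually (gt_mem_nhds hδ)).exists
  exact (hfar n).not_gt hn

theorem continuous_powerMoment (m : ℕ) :
    Continuous fun ν : FiniteMeasure I => powerMoment (ν : Measure I) m :=
  FiniteMeasure.continuous_integral_continuousMap (⟨fun y : I => (y : ℝ) ^ m, by fun_prop⟩ : C(I, ℝ))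

theorem setOf_momentsClose_mem_nhds (M : ℕ) (ν : FiniteMeasure I) :
    {μ : FiniteMeasure I | MomentsClose M (powerMoment (μ : Measure I))
      (powerMoment (ν : Measure I))} ∈ 𝓝 ν := by
  have : ∀ m ∈ Set.Iic M, {μ : FiniteMeasure I | |powerMoment (μ : Measure I) m
      - powerMoment (ν : Measure I) m| < 1 / ((M : ℝ) + 1)} ∈ 𝓝 ν := fun m _ => by
    refine (((continuous_powerMoment m).sub continuous_const).abs.tendsto ν).eventually
      (gt_mem_nhds ?_)
    have h0 : 0 < 1 / ((M : ℝ) + 1) := by positivity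
    simpa using h0
  filter_upwards [(biInter_mem (Set.finite_Iic M)).2 this] with μ hμ m hm
  exact Set.mem_iInter₂.1 hμ m hm

theorem momentsClose_of_levyProkhorovEDist_lt (ν : Measure I) [IsProbabilityMeasure ν] (M : ℕ) :
    ∃ δ : ℝ≥0∞, 0 < δ ∧ ∀ (μ : Measure I) [IsProbabilityMeasure μ],
      levyProkhorovEDist μ ν < δ → MomentsClose M (powerMoment μ) (powerMoment ν) := by
  have hcont : Continuous fun μ : LevyProkhorov (ProbabilityMeasure I) =>
      μ.toMeasure.toFiniteMeasure :=
    ProbabilityMeasure.toFiniteMeasure_continuous.comp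
      LevyProkhorov.continuous_toMeasure_probabilityMeasure
  have h1 := (hcont.tendsto (LevyProkhorov.ofMeasure ⟨ν, inferInstance⟩)).eventually
    (setOf_momentsClose_mem_nhds M _)
  obtain ⟨δ, hδ, h2⟩ := EMetric.mem_nhds_iff.1 h1
  exact ⟨δ, hδ, fun μ _ hμ => h2 (show LevyProkhorov.ofMeasure (⟨μ, inferInstance⟩ :
    ProbabilityMeasure I) ∈ _ from hμ)⟩

theorem isProbabilityMeasure_pathEmpiricalMeasure {D : ℕ} (U : ℕ → Fin D → I) {n : ℕ}
    (hn : n ≠ 0) (π : Fin n → Fin D) : IsProbabilityMeasure (pathEmpiricalMeasure U π) := by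
  constructor
  simp only [pathEmpiricalMeasure, Measure.smul_apply, Measure.finsetSum_apply, measure_univ,
    Finset.sum_const, Finset.card_univ, Fintype.card_fin, smul_eq_mul, nsmul_eq_mul, mul_one]
  exact ENNReal.inv_mul_cancel (by exact_mod_cast hn) (ENNReal.natCast_ne_top n)

/-- The moments of the empirical measure along the path `π`. -/
def pathMoment {D : ℕ} (U : ℕ → Fin D → I) {n : ℕ} (π : Fin n → Fin D) (m : ℕ) : ℝ :=
  (n : ℝ)⁻¹ * ∑ i : Fin n, (U i (π i) : ℝ) ^ m

theorem powerMoment_pathEmpiricalMeasure {D : ℕ} (U : ℕ → Fin D → I) {n : ℕ} (π : Fin n → Fin D) :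
    powerMoment (pathEmpiricalMeasure U π) = pathMoment U π := by
  ext m
  rw [powerMoment, pathEmpiricalMeasure, integral_smul_measure,
    integral_finsetSum_measure fun i _ => integrable_coe_pow _ m]
  simp [pathMoment]

/-- The paths in the environment `U` can be chosen so that their empirical moments converge to the
moments `a`. -/
def HasPathsWithMoments {D : ℕ} (U : ℕ → Fin D → I) (a : ℕ → ℝ) : Prop :=
  ∀ M : ℕ, ∀ᶠ n in atTop, ∃ π : Fin n → Fin D, MomentsClose M (pathMoment U π) a

theorem hasPathsWithMoments_of_tendsto {D : ℕ} {U : ℕ → Fin D → I} {ν : FiniteMeasure I}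
    [IsProbabilityMeasure (ν : Measure I)] {α : ℝ} (hα : 0 ≤ α)
    (h : Tendsto (fun n : ℕ => pathOrderStatistic U ν n ⌊Real.exp (α * n)⌋₊) atTop (𝓝 0)) :
    HasPathsWithMoments U (powerMoment (ν : Measure I)) := by
  intro M
  obtain ⟨δ, hδ, hclose⟩ := momentsClose_of_levyProkhorovEDist_lt (ν : Measure I) M
  filter_upwards [h.eventually (gt_mem_nhds hδ), eventually_ne_atTop 0] with n hn hn0
  obtain ⟨r, hr, hrδ⟩ := sInf_lt_iff.1 hn
  have h1 : 1 ≤ ⌊Real.exp (α * n)⌋₊ := Nat.le_floor (by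
    rw [Nat.cast_one]; exact Real.one_le_exp (by positivity))
  have h2 : Set.ncard {π : Fin n → Fin D |
      levyProkhorovEDist (pathEmpiricalMeasure U π) (ν : Measure I) ≤ r} ≠ 0 := by
    have := h1.trans hr
    lia
  obtain ⟨π, hπ⟩ := Set.nonempty_of_ncard_ne_zero h2
  have := isProbabilityMeasure_pathEmpiricalMeasure U hn0 π
  refine ⟨π, ?_⟩
  rw [← powerMoment_pathEmpiricalMeasure]
  exact hclose _ (lt_of_le_of_lt hπ hrδ)

theorem tendsto_of_hasPathsWithMoments {D : ℕ} {U : ℕ → Fin D → I} {ν : FiniteMeasure I}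
    [IsProbabilityMeasure (ν : Measure I)]
    (h : HasPathsWithMoments U (powerMoment (ν : Measure I))) :
    Tendsto (fun n : ℕ => pathOrderStatistic U ν n 1) atTop (𝓝 0) := by
  rw [ENNReal.tendsto_nhds_zero]
  intro δ hδ
  obtain ⟨M, hM⟩ := levyProkhorovEDist_le_of_momentsClose (ν : Measure I) hδ
  filter_upwards [h M, eventually_ne_atTop 0] with n hn hn0
  obtain ⟨π, hπ⟩ := hn
  have := isProbabilityMeasure_pathEmpiricalMeasure U hn0 π
  refine sInf_le ?_
  refine (Set.ncard_pos (Set.toFinite _)).2 ⟨π, hM _ ?_⟩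
  rwa [powerMoment_pathEmpiricalMeasure]

/-- `ℛ` consists of the probability measures whose moments are a.s. limits of the moments of
empirical measures along paths. -/
theorem mem_finiteGridEntropyMeasures_iff {D : ℕ} {ν : FiniteMeasure I} :
    ν ∈ finiteGridEntropyMeasures D ↔ ν.mass = 1 ∧
      ∀ᵐ U ∂(environmentLaw D), HasPathsWithMoments U (powerMoment (ν : Measure I)) := by
  refine and_congr_right fun hmass => ?_
  have : IsProbabilityMeasure (ν : Measure I) :=
    ⟨by rw [← FiniteMeasure.ennreal_mass, hmass, ENNReal.coe_one]⟩
  constructor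
  · intro h
    by_contra hcon
    have hempty : {α : ℝ | 0 ≤ α ∧ ∀ᵐ U ∂(environmentLaw D), Tendsto (fun n : ℕ =>
        pathOrderStatistic U ν n ⌊Real.exp (α * n)⌋₊) atTop (𝓝 0)} = ∅ := by
      ext α
      simp only [Set.mem_ofPred_eq, Set.mem_empty_iff_false, iff_false, not_and]
      intro hα hU
      exact hcon (hU.mono fun U => hasPathsWithMoments_of_tendsto hα)
    rw [gridEntropy, hempty] at h
    simp at h
  · intro h
    refine le_sSup ⟨0, ⟨le_rfl, ?_⟩, rfl⟩
    filter_upwards [h] with U hU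
    simpa using tendsto_of_hasPathsWithMoments hU

/-- The strong law of large numbers for a bounded function of independent samples. -/
theorem strong_law_infinitePi {α : Type*} [MeasurableSpace α] (P : Measure α)
    [IsProbabilityMeasure P] {g : α → ℝ} (hg : Measurable g) {C : ℝ} (hC : ∀ x, |g x| ≤ C) :
    ∀ᵐ x ∂(Measure.infinitePi fun _ : ℕ => P),
      Tendsto (fun n : ℕ => (n : ℝ)⁻¹ * ∑ i : Fin n, g (x i)) atTop (𝓝 (∫ a, g a ∂P)) := by
  have hmp : ∀ i : ℕ, MeasurePreserving (fun x : ℕ → α => x i)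
      (Measure.infinitePi fun _ : ℕ => P) P := fun i =>
    measurePreserving_eval_infinitePi (fun _ : ℕ => P) i
  have hgi : Integrable g P := integrable_of_measurable_of_abs_le hg hC
  have h := strong_law_ae_real (μ := Measure.infinitePi fun _ : ℕ => P) (fun i x => g (x i))
    ((hmp 0).integrable_comp_of_integrable hgi)
    (fun i j hij => (iIndepFun_infinitePi (P := fun _ : ℕ => P) (X := fun _ => g)
      fun _ => hg).indepFun hij)
    (fun i => ⟨(hg.comp (measurable_pi_apply i)).aemeasurable,
      (hg.comp (measurable_pi_apply 0)).aemeasurable, by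
        have e : ∀ i : ℕ, (Measure.infinitePi fun _ : ℕ => P).map (fun x => g (x i)) = P.map g :=
          fun i => by
            have h1 := congrArg (Measure.map g) (hmp i).map_eq
            rwa [Measure.map_map hg (measurable_pi_apply i)] at h1
        rw [e, e]⟩)
  have hint : ∫ x, g (x 0) ∂(Measure.infinitePi fun _ : ℕ => P) = ∫ a, g a ∂P := by
    rw [← (hmp 0).map_eq, integral_map (measurable_pi_apply 0).aemeasurable]
    · rw [(hmp 0).map_eq]
    · exact hg.aestronglyMeasurable
  rw [hint] at h
  filter_upwards [h] with x hx
  refine hx.congr fun n => ?_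
  rw [div_eq_inv_mul, Finset.sum_range]

theorem measurableSet_hasPathsWithMoments {D : ℕ} (a : ℕ → ℝ) :
    MeasurableSet {U : ℕ → Fin D → I | HasPathsWithMoments U a} := by
  have h1 : ∀ (n : ℕ) (π : Fin n → Fin D) (M : ℕ),
      MeasurableSet {U : ℕ → Fin D → I | MomentsClose M (pathMoment U π) a} := by
    intro n π M
    simp only [MomentsClose, pathMoment, Set.ofPred_forall]
    refine MeasurableSet.iInter fun m => MeasurableSet.iInter fun _ => ?_
    exact measurableSet_lt (by fun_prop) measurable_const
  have h2 : {U : ℕ → Fin D → I | HasPathsWithMoments U a}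
      = ⋂ M : ℕ, ⋃ N : ℕ, ⋂ n : ℕ, ⋂ _ : N ≤ n, ⋃ π : Fin n → Fin D,
        {U : ℕ → Fin D → I | MomentsClose M (pathMoment U π) a} := by
    ext U
    simp [HasPathsWithMoments, eventually_atTop]
  rw [h2]
  exact MeasurableSet.iInter fun M => MeasurableSet.iUnion fun N => MeasurableSet.iInter fun n =>
    MeasurableSet.iInter fun _ => MeasurableSet.iUnion fun π => h1 n π M

namespace SingleEdgeStrategy

variable {D : ℕ}

theorem ae_hasPathsWithMoments (p : SingleEdgeStrategy D) :
    ∀ᵐ U ∂(environmentLaw D), HasPathsWithMoments U (powerMoment (p.law : Measure I)) := by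
  have hmap : (Measure.infinitePi fun _ : ℕ => p.jointLaw).map (fun x i => (x i).1)
      = environmentLaw D := by
    rw [Measure.infinitePi_map_pi (fun _ : ℕ => p.jointLaw) (f := fun _ => Prod.fst)
      fun _ => measurable_fst]
    simp only [p.map_fst_jointLaw]
    rfl
  have hm : Measurable fun (x : ℕ → (Fin D → I) × Fin D) i => (x i).1 := by fun_prop
  rw [← hmap, ae_map_iff hm.aemeasurable (measurableSet_hasPathsWithMoments _)]
  have hslln := ae_all_iff.2 fun m : ℕ => strong_law_infinitePi p.jointLaw
    (g := fun z => (z.1 z.2 : ℝ) ^ m)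
    ((measurable_subtype_coe.comp measurable_chosen).pow_const m)
    fun z => abs_coe_pow_le_one m _
  filter_upwards [hslln] with x hx M
  have h1 : ∀ m ∈ Set.Iic M, ∀ᶠ n : ℕ in atTop,
      |pathMoment (fun i => (x i).1) (fun i : Fin n => (x i).2) m
        - powerMoment (p.law : Measure I) m| < 1 / ((M : ℝ) + 1) := by
    intro m _
    have h2 : ∫ z, (z.1 z.2 : ℝ) ^ m ∂p.jointLaw = powerMoment (p.law : Measure I) m := by
      have h3 : (p.law : Measure I) = p.jointLaw.map (fun x => x.1 x.2) := rfl
      rw [powerMoment, h3, integral_map measurable_chosen.aemeasurable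
        (by fun_prop : Measurable fun y : I => (y : ℝ) ^ m).aestronglyMeasurable]
    have h3 := hx m
    rw [h2] at h3
    exact Metric.tendsto_nhds.1 h3 (1 / ((M : ℝ) + 1)) (by positivity)
  filter_upwards [(eventually_all_finite (Set.finite_Iic M)).2 h1] with n hn
  exact ⟨fun i => (x i).2, fun m hm => hn m hm⟩

theorem mass_law (p : SingleEdgeStrategy D) : p.law.mass = 1 := by
  have h : ((p.law.mass : ℝ≥0) : ℝ≥0∞) = 1 := by
    rw [FiniteMeasure.ennreal_mass, measure_univ]
  exact_mod_cast h

theorem achievableLaws_subset_finiteGridEntropyMeasures :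
    achievableLaws D ⊆ finiteGridEntropyMeasures D := by
  rintro _ ⟨p, rfl⟩
  exact mem_finiteGridEntropyMeasures_iff.2 ⟨p.mass_law, p.ae_hasPathsWithMoments⟩

end SingleEdgeStrategy

theorem isClosed_finiteGridEntropyMeasures (D : ℕ) : IsClosed (finiteGridEntropyMeasures D) := by
  refine isClosed_of_closure_subset fun ν hν => ?_
  refine mem_finiteGridEntropyMeasures_iff.2 ⟨?_, ?_⟩
  · exact closure_minimal (fun μ hμ => (mem_finiteGridEntropyMeasures_iff.1 hμ).1)
      (isClosed_singleton.preimage FiniteMeasure.continuous_mass) hν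
  · have h1 : ∀ M : ℕ, ∀ᵐ U ∂(environmentLaw D), ∀ᶠ n in atTop, ∃ π : Fin n → Fin D,
        MomentsClose M (pathMoment U π) (powerMoment (ν : Measure I)) := by
      intro M
      obtain ⟨μ, hμν, hμ⟩ := mem_closure_iff_nhds.1 hν _
        (setOf_momentsClose_mem_nhds (2 * M + 1) ν)
      filter_upwards [(mem_finiteGridEntropyMeasures_iff.1 hμ).2] with U hU
      filter_upwards [hU (2 * M + 1)] with n hn
      obtain ⟨π, hπ⟩ := hn
      refine ⟨π, fun m hm => ?_⟩
      have e1 := hπ m (by lia)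
      have e2 := hμν m (by lia)
      have e3 : (1 : ℝ) / (M + 1) = 1 / (((2 * M + 1 : ℕ) : ℝ) + 1)
          + 1 / (((2 * M + 1 : ℕ) : ℝ) + 1) := by
        push_cast
        field_simp
        ring
      rw [e3]
      exact (abs_sub_le _ _ _).trans_lt (add_lt_add e1 e2)
    exact ae_all_iff.2 h1

namespace SingleEdgeStrategy

variable {D : ℕ}

theorem le_sum_greedy_prob_mul [NeZero D] {h : I → ℝ} (hh : Measurable h) (u : Fin D → I)
    (k : Fin D) : h (u k) ≤ ∑ l, (greedy h hh : SingleEdgeStrategy D).prob l u * h (u l) := by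
  set q : SingleEdgeStrategy D := greedy h hh
  calc h (u k) = ∑ l, q.prob l u * h (u k) := by rw [← Finset.sum_mul, q.sum_prob, one_mul]
    _ ≤ _ := by
      refine Finset.sum_le_sum fun l _ => ?_
      rcases le_or_gt (h (u k)) (h (u l)) with hle | hlt
      · exact mul_le_mul_of_nonneg_left hle (q.prob_nonneg _ _)
      · have : q.prob l u = 0 := maxWeight_eq_zero (x := fun i => h (u i)) hlt
        simp [this]

/-- The greedy strategy for a polynomial is optimal among all measures in `ℛ`. -/
theorem integral_le_integral_greedy [NeZero D] {ν : FiniteMeasure I}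
    (hν : ν ∈ finiteGridEntropyMeasures D) (P : Polynomial ℝ)
    (hP : Measurable fun y : I => P.eval (y : ℝ)) :
    ∫ y, P.eval (y : ℝ) ∂(ν : Measure I)
      ≤ ∫ y, P.eval (y : ℝ) ∂((greedy _ hP : SingleEdgeStrategy D).law : Measure I) := by
  set q : SingleEdgeStrategy D := greedy _ hP with hq
  set d := P.natDegree
  set A := ∑ m ∈ Finset.range (d + 1), |P.coeff m| with hA
  have hA0 : 0 ≤ A := Finset.sum_nonneg fun _ _ => abs_nonneg _
  have hbd : ∀ y : I, |P.eval (y : ℝ)| ≤ A := fun y => by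
    rw [Polynomial.eval_eq_sum_range]
    refine (Finset.abs_sum_le_sum_abs _ _).trans (Finset.sum_le_sum fun m _ => ?_)
    rw [abs_mul]
    exact mul_le_of_le_one_right (abs_nonneg _) (abs_coe_pow_le_one m y)
  have hqm := q.measurable_prob
  have hg : Measurable fun u : Fin D → I => ∑ l, q.prob l u * P.eval (u l : ℝ) := by fun_prop
  have hgb : ∀ u : Fin D → I, |∑ l, q.prob l u * P.eval (u l : ℝ)| ≤ ∑ _l : Fin D, A :=
    fun u => (Finset.abs_sum_le_sum_abs _ _).trans
      (Finset.sum_le_sum fun l _ => q.abs_prob_mul_le hbd l u (u l))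
  have : IsProbabilityMeasure (environmentLaw D) := by
    unfold environmentLaw; infer_instance
  have hslln := strong_law_infinitePi volume hg hgb
  rw [← environmentLaw] at hslln
  obtain ⟨U, hU, hlim⟩ := ((mem_finiteGridEntropyMeasures_iff.1 hν).2.and
    hslln).exists
  rw [← q.integral_law hP hbd] at hlim
  rw [integral_polynomial_eval]
  have hM : ∀ᶠ M : ℕ in atTop, ∑ m ∈ Finset.range (d + 1),
      P.coeff m * powerMoment (ν : Measure I) m - A * (1 / ((M : ℝ) + 1))
        ≤ ∫ y, P.eval (y : ℝ) ∂(q.law : Measure I) := by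
    filter_upwards [eventually_ge_atTop d] with M hMd
    refine ge_of_tendsto hlim ?_
    filter_upwards [hU M] with n hn
    obtain ⟨π, hπ⟩ := hn
    have h1 : ∑ m ∈ Finset.range (d + 1), P.coeff m * pathMoment U π m
        ≤ (n : ℝ)⁻¹ * ∑ i : Fin n, ∑ l, q.prob l (U i) * P.eval (U i l : ℝ) := by
      have h2 : ∑ m ∈ Finset.range (d + 1), P.coeff m * pathMoment U π m
          = (n : ℝ)⁻¹ * ∑ i : Fin n, P.eval (U i (π i) : ℝ) := by
        simp only [pathMoment, Polynomial.eval_eq_sum_range, Finset.mul_sum]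
        rw [Finset.sum_comm]
        exact Finset.sum_congr rfl fun _ _ => Finset.sum_congr rfl fun _ _ => by ring
      rw [h2]
      exact mul_le_mul_of_nonneg_left (Finset.sum_le_sum fun i _ =>
        le_sum_greedy_prob_mul hP (U i) (π i)) (by positivity)
    have h3 : ∑ m ∈ Finset.range (d + 1), P.coeff m * powerMoment (ν : Measure I) m
        - ∑ m ∈ Finset.range (d + 1), P.coeff m * pathMoment U π m
          ≤ A * (1 / ((M : ℝ) + 1)) := by
      rw [← Finset.sum_sub_distrib, hA, Finset.sum_mul]
      refine Finset.sum_le_sum fun m hm => ?_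
      rw [← mul_sub]
      refine (le_abs_self _).trans ?_
      rw [abs_mul, abs_sub_comm]
      exact mul_le_mul_of_nonneg_left (hπ m (by
        have := Finset.mem_range.1 hm
        lia)).le (abs_nonneg _)
    linarith
  have hlim2 := (tendsto_one_div_add_atTop_nhds_zero_nat (𝕜 := ℝ)).const_mul A
  have hlim3 := hlim2.const_sub (∑ m ∈ Finset.range (d + 1),
    P.coeff m * powerMoment (ν : Measure I) m)
  rw [mul_zero, sub_zero] at hlim3
  exact le_of_tendsto hlim3 hM

theorem volume_eval_eq_const {P : Polynomial ℝ} (hP : ∀ c, P ≠ Polynomial.C c) (c : ℝ) :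
    volume {y : I | P.eval (y : ℝ) = c} = 0 := by
  refine Set.Finite.measure_zero (by_contra fun hinf => hP c ?_) _
  refine Polynomial.eq_of_infinite_eval_eq _ _ ?_
  refine (Set.Infinite.image (Subtype.val_injective.injOn) hinf).mono ?_
  rintro _ ⟨y, hy, rfl⟩
  simpa using hy

theorem map_density_greedy [NeZero D] {h : I → ℝ} (hh : Measurable h)
    (hlev : ∀ c, volume {y | h y = c} = 0) :
    (volume : Measure I).map (greedy h hh : SingleEdgeStrategy D).density
      = (volume : Measure I).map (maxDensity D) :=
  ((isOptimalFor_greedy hh).isGreedyFor hh hlev).map_density hh hlev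

end SingleEdgeStrategy

open SingleEdgeStrategy in
theorem exists_mem_convexHull_momentsClose {D : ℕ} [NeZero D] {ν : FiniteMeasure I}
    (hν : ν ∈ finiteGridEntropyMeasures D) (M : ℕ) :
    ∃ τ ∈ convexHull ℝ≥0 {ν : FiniteMeasure I | ∃ p : SingleEdgeStrategy D, p.law = ν ∧
        (volume : Measure I).map p.density = (volume : Measure I).map (maxDensity D)},
      MomentsClose M (powerMoment (τ : Measure I)) (powerMoment (ν : Measure I)) := by
  set S := {ν : FiniteMeasure I | ∃ p : SingleEdgeStrategy D, p.law = ν ∧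
        (volume : Measure I).map p.density = (volume : Measure I).map (maxDensity D)}
  let T : FiniteMeasure I → Fin (M + 1) → ℝ := fun μ m => powerMoment (μ : Measure I) m
  have hT : ∀ (a b : ℝ≥0) (μ κ : FiniteMeasure I),
      T (a • μ + b • κ) = (a : ℝ) • T μ + (b : ℝ) • T κ := by
    intro a b μ κ
    ext m
    have e1 : ((a • μ + b • κ : FiniteMeasure I) : Measure I)
        = a • (μ : Measure I) + b • (κ : Measure I) := rfl
    simp only [T, powerMoment, e1, Pi.add_apply, Pi.smul_apply]
    rw [integral_add_measure (integrable_coe_pow _ _).smul_measure_nnreal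
      (integrable_coe_pow _ _).smul_measure_nnreal, integral_smul_nnreal_measure,
      integral_smul_nnreal_measure]
    rfl
  have hconv : Convex ℝ (T '' convexHull ℝ≥0 S) := by
    rintro _ ⟨μ, hμ, rfl⟩ _ ⟨κ, hκ, rfl⟩ a b ha hb hab
    lift a to ℝ≥0 using ha
    lift b to ℝ≥0 using hb
    exact ⟨a • μ + b • κ, convex_convexHull ℝ≥0 S hμ hκ zero_le zero_le (by exact_mod_cast hab),
      hT a b μ κ⟩
  have hmem : T ν ∈ closure (T '' convexHull ℝ≥0 S) := by
    by_contra hnot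
    obtain ⟨F, c, hF, hFν⟩ := geometric_hahn_banach_closed_point hconv.closure isClosed_closure hnot
    have hFS : ∀ p : SingleEdgeStrategy D,
        (volume : Measure I).map p.density = (volume : Measure I).map (maxDensity D) →
        F (T p.law) < c := fun p hp =>
      hF _ (subset_closure ⟨p.law, subset_convexHull _ _ ⟨p, rfl, hp⟩, rfl⟩)
    let P : Polynomial ℝ := ∑ m : Fin (M + 1),
      Polynomial.C (F (Pi.single m 1)) * Polynomial.X ^ (m : ℕ)
    have hP : Measurable fun y : I => P.eval (y : ℝ) := by fun_prop
    have hFP : ∀ μ : FiniteMeasure I, F (T μ) = ∫ y, P.eval (y : ℝ) ∂(μ : Measure I) := by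
      intro μ
      simp only [P, Polynomial.eval_finsetSum, Polynomial.eval_mul, Polynomial.eval_C,
        Polynomial.eval_pow, Polynomial.eval_X]
      rw [integral_finsetSum _ fun m _ => (integrable_coe_pow _ _).const_mul _]
      conv_lhs => rw [pi_eq_sum_univ' (T μ), map_sum]
      refine Finset.sum_congr rfl fun m _ => ?_
      rw [integral_const_mul, map_smul, smul_eq_mul, mul_comm]
      rfl
    by_cases hconst : ∃ c, P = Polynomial.C c
    · obtain ⟨b, hb⟩ := hconst
      have hid : Measurable fun y : I => (y : ℝ) := measurable_subtype_coe
      have h1 := hFS _ (map_density_greedy (D := D) hid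
        volume_unitInterval_singleton_eq_zero)
      have hνm : (ν : Measure I).real Set.univ = 1 := by
        rw [Measure.real, ← FiniteMeasure.ennreal_mass,
          (mem_finiteGridEntropyMeasures_iff.1 hν).1]
        simp
      rw [hFP] at h1 hFν
      simp only [hb, Polynomial.eval_C, integral_const, hνm, probReal_univ] at h1 hFν
      exact lt_asymm h1 hFν
    · push Not at hconst
      have h1 := hFS _ (map_density_greedy (D := D) hP (volume_eval_eq_const hconst))
      rw [hFP] at h1 hFν
      exact (integral_le_integral_greedy hν P hP).not_gt (h1.trans hFν)
  obtain ⟨_, ⟨τ, hτ, rfl⟩, hdist⟩ := Metric.mem_closure_iff.1 hmem (1 / ((M : ℝ) + 1))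
    (by positivity)
  refine ⟨τ, hτ, fun m hm => ?_⟩
  rw [dist_comm] at hdist
  exact (dist_le_pi_dist (T τ) (T ν) ⟨m, by lia⟩).trans_lt hdist

open SingleEdgeStrategy in
theorem finiteGridEntropyMeasures_eq_closure_convexHull {D : ℕ} [NeZero D] :
    finiteGridEntropyMeasures D =
      closure (convexHull ℝ≥0 {ν : FiniteMeasure I | ∃ p : SingleEdgeStrategy D, p.law = ν ∧
        (volume : Measure I).map p.density = (volume : Measure I).map (maxDensity D)}) := by
  have hsub : convexHull ℝ≥0 {ν : FiniteMeasure I | ∃ p : SingleEdgeStrategy D, p.law = ν ∧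
      (volume : Measure I).map p.density = (volume : Measure I).map (maxDensity D)}
        ⊆ achievableLaws D :=
    convexHull_min (fun ν ⟨p, hp, _⟩ => ⟨p, hp⟩) convex_achievableLaws
  refine Set.Subset.antisymm (fun ν hν => ?_) (closure_minimal
    (hsub.trans achievableLaws_subset_finiteGridEntropyMeasures)
    (isClosed_finiteGridEntropyMeasures D))
  choose τ hτ hclose using exists_mem_convexHull_momentsClose hν
  have hprob : ∀ μ : FiniteMeasure I, μ.mass = 1 → IsProbabilityMeasure (μ : Measure I) :=
    fun μ hμ => ⟨by rw [← FiniteMeasure.ennreal_mass, hμ, ENNReal.coe_one]⟩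
  have := hprob ν hν.1
  have : ∀ n, IsProbabilityMeasure (τ n : Measure I) := fun n => hprob _ (by
    obtain ⟨p, hp⟩ := hsub (hτ n)
    rw [← hp, p.mass_law])
  refine mem_closure_of_tendsto (f := τ) (b := atTop) ?_ (Eventually.of_forall hτ)
  exact FiniteMeasure.tendsto_of_forall_integral_tendsto fun f =>
    tendsto_integral_of_tendsto_powerMoment (tendsto_of_forall_momentsClose hclose) f

end
theorem theoremB (D : ℕ) (hD : 2 ≤ D) :
    (∀ p : SingleEdgeStrategy D,
      -- `σ_p` has density `f_p` with respect to Lebesgue measure on `[0,1]`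
      (p.law : Measure I) =
        (volume : Measure I).withDensity (fun y => ENNReal.ofReal (p.density y)) ∧
      List.TFAE [
        -- `σ_p` is an extreme point of the set of all achievable laws
        p.law ∈ Set.extremePoints ℝ≥0 (achievableLaws D),
        -- every consistent strategy achieving `σ_p` is deterministic
        ∀ q : SingleEdgeStrategy D, q.IsConsistent → q.law = p.law → q.IsDeterministic,
        -- `f_p` has no level sets of positive measure, and `σ_p` is achieved by the greedy strategy
        (∀ c : ℝ, volume {y : I | p.density y = c} = 0) ∧
          ∃ q : SingleEdgeStrategy D, q.IsGreedyFor p.density ∧ q.law = p.law,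
        -- for uniform `U`, `f_p(U) / D` is Beta distributed
        (volume : Measure I).map (fun y => p.density y / D) = betaMeasure (1 / ((D : ℝ) - 1)) 1,
        -- `f_p` and `f_MAX` have the same value distribution
        (volume : Measure I).map p.density = (volume : Measure I).map (maxDensity D)]) ∧
    -- `ℛ` is the closed convex hull of these measures
    finiteGridEntropyMeasures D =
      closure (convexHull ℝ≥0 {ν : FiniteMeasure I | ∃ p : SingleEdgeStrategy D, p.law = ν ∧
        (volume : Measure I).map p.density = (volume : Measure I).map (maxDensity D)}) := by
  have : NeZero D := ⟨by lia⟩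
  exact ⟨fun p => ⟨p.law_eq_withDensity, p.tfae_extreme_consistent_greedy_beta_map hD⟩,
    finiteGridEntropyMeasures_eq_closure_convexHull⟩
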